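/- Let $\nu>0$, $T>0$, and let $\chi_c\in C_0^\infty(\mathbb R)$. Put $H=L^2(\mathbb R)$, $V=H^1(\mathbb R)$ and $W(V)=\{y\in L^2(0,T;V)\mid \partial_t y\in L^2(0,T;V^*)\}$ with $\|y\|_{W(V)}^2=\|y\|_{L^2(0,T;V)}^2+\|\partial_t y\|_{L^2(0,T;V^*)}^2$; values $y(t)\in H$ of $y\in W(V)$ are those of its representative in $C([0,T];H)$. For $u\in H^1(0,T)$, $y_0\in V$ and $C>0$ put $$C_{state}=C\,(\|u\|_{L^2(0,T)}+\|y_0\|_V)^2\exp\big(C(\|u\|_{L^2(0,T)}^2+\|y_0\|_H^2)\big).$$ There is a constant $C_0>0$, depending only on $\nu,T,\chi_c$, such that for every $C\ge C_0$ and every $\delta>0$ there is a constant $c>0$, depending only on $\nu,T,\chi_c,C,\delta$, with the following property. Let $y_0\in V$ and $y_d\in H$ have bounded support, let $u\in H^1(0,T)$ with $u_l\le u\le u_u$ a.e. for some real $u_l,u_u$, and suppose $\|u\|_{L^2(0,T)}+\|y_0\|_V\ge\delta$. Let $\delta_\varepsilon(x)=\varepsilon^{-1}\zeta(\varepsilon^{-1}x)$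 with $\varepsilon>0$, where $\zeta\in C^\infty(\mathbb R)\cap L^1(\mathbb R)$ satisfies, for some integer $r\ge1$, $\int\zeta=1$, $\int x^k\zeta(x)\,dx=0$ for $1\le k\le r-1$ and $\int|x|^r|\zeta(x)|\,dx<\infty$. Let $N\in\mathbb N$, $X\in\mathbb R^N$, and let $(y_h,\Phi)\in (W(V)\cap L^\infty(0,T;V))\times H^1(0,T)^N$ solve the discrete state problem: for some functions $\alpha_1,\dots,\alpha_N$ on $(0,T)$, $$y_h(x,t)=\sum_{i=1}^N\alpha_i(t)\,\delta_\varepsilon(x-\Phi_i(t)),\qquad \partial_t\Phi_i(t)=y_h(\Phi_i(t),t),\qquad \Phi_i(0)=X_i,$$ and for a.e. $t\in(0,T)$ and all $\phi\in V$, $\psi\in H$, $$\langle\partial_t y_h(t),\phi\rangle_{V^*,V}+\langle y_h(t)\partial_x y_h(t),\phi\rangle_H+\nu\langle\partial_x y_h(t),\partial_x\phi\rangle_H=\langle\chi_c u(t),\phi\rangle_H,\qquad \langle y_h(0),\psi\rangle_H=\langle y_0,\psi\rangle_H .$$ Let $p_h\in W(V)$ solve the adjoint equation: for a.e. $t\in(0,T)$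 and all $\phi\in V$, $\psi\in H$, $$\langle\partial_t p_h(t),\phi\rangle_{V^*,V}+\langle y_h(t)\partial_x p_h(t),\phi\rangle_H-\nu\langle\partial_x p_h(t),\partial_x\phi\rangle_H=0,\qquad \langle p_h(T),\psi\rangle_H=\langle y_d-y_h(T),\psi\rangle_H$$ (for instance, but not necessarily, $p_h(x,t)=\sum_i\beta_i(t)\delta_\varepsilon(x-\Phi_i(t))$). Then $$\|p_h\|_{W(V)}\le c\,(C_{state}^4+C_{state}^2)\,\|y_h(T)-y_d\|_H .$$ -/

import Mathlib

open MeasureTheory Set Filter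
open scoped ContDiff ENNReal RealInnerProductSpace

noncomputable section

namespace BurgersControl

/-! ## Weak derivatives and first order Sobolev spaces on open subsets of the line -/

/-- `g` is the weak derivative of `f` on the open set `Ω ⊆ ℝ`: one integrates by parts against
smooth functions whose compact support lies in `Ω`. -/
def HasWeakDerivOn (Ω : Set ℝ) (f g : ℝ → ℝ) : Prop :=
  ∀ φ : ℝ → ℝ, ContDiff ℝ ∞ φ → HasCompactSupport φ → tsupport φ ⊆ Ω →
    ∫ x in Ω, f x * deriv φ x = -∫ x in Ω, g x * φ x

theorem integrable_mul_test {Ω : Set ℝ} {f φ : ℝ → ℝ} (hf : MemLp f 2 (volume.restrict Ω))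
    (hφ : Continuous φ) (hc : HasCompactSupport φ) :
    Integrable (fun x => f x * φ x) (volume.restrict Ω) :=
  MemLp.integrable_mul (p := 2) (q := 2) hf (hφ.memLp_of_hasCompactSupport hc)

theorem HasWeakDerivOn.congr {Ω : Set ℝ} {f g f' g' : ℝ → ℝ} (h : HasWeakDerivOn Ω f g)
    (hf : f' =ᵐ[volume.restrict Ω] f) (hg : g' =ᵐ[volume.restrict Ω] g) :
    HasWeakDerivOn Ω f' g' := by
  intro φ h1 h2 h3
  have e1 : ∫ x in Ω, f' x * deriv φ x = ∫ x in Ω, f x * deriv φ x :=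
    integral_congr_ae (by filter_upwards [hf] with x hx; rw [hx])
  have e2 : ∫ x in Ω, g' x * φ x = ∫ x in Ω, g x * φ x :=
    integral_congr_ae (by filter_upwards [hg] with x hx; rw [hx])
  rw [e1, e2, h φ h1 h2 h3]

theorem HasWeakDerivOn.add {Ω : Set ℝ} {f g f' g' : ℝ → ℝ}
    (h : HasWeakDerivOn Ω f g) (h' : HasWeakDerivOn Ω f' g')
    (hf : MemLp f 2 (volume.restrict Ω)) (hg : MemLp g 2 (volume.restrict Ω))
    (hf' : MemLp f' 2 (volume.restrict Ω)) (hg' : MemLp g' 2 (volume.restrict Ω)) :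
    HasWeakDerivOn Ω (f + f') (g + g') := by
  intro φ h1 h2 h3
  have hd : Continuous (deriv φ) := h1.continuous_deriv (by simp)
  simp only [Pi.add_apply, add_mul]
  rw [integral_add (integrable_mul_test hf hd h2.deriv) (integrable_mul_test hf' hd h2.deriv),
    integral_add (integrable_mul_test hg h1.continuous h2)
      (integrable_mul_test hg' h1.continuous h2), h φ h1 h2 h3, h' φ h1 h2 h3, neg_add]

theorem HasWeakDerivOn.smul {Ω : Set ℝ} {f g : ℝ → ℝ} (h : HasWeakDerivOn Ω f g) (a : ℝ) :
    HasWeakDerivOn Ω (a • f) (a • g) := by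
  intro φ h1 h2 h3
  simp only [Pi.smul_apply, smul_eq_mul, mul_assoc]
  rw [integral_const_mul, integral_const_mul, h φ h1 h2 h3, mul_neg]

theorem hasWeakDerivOn_zero {Ω : Set ℝ} : HasWeakDerivOn Ω 0 0 := by
  intro φ _ _ _
  simp

/-- The Lebesgue space `L²(Ω)`. -/
abbrev L2 (Ω : Set ℝ) : Type := Lp ℝ 2 (volume.restrict Ω)

/-- The Sobolev space `H¹(Ω)`, as the space of pairs `(f, f')` of a function in `L²(Ω)` and its
weak derivative in `L²(Ω)`. The norm is `‖f‖² + ‖f'‖²` under the square root. -/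
def H1Submodule (Ω : Set ℝ) : Submodule ℝ (WithLp 2 (L2 Ω × L2 Ω)) where
  carrier := {w | HasWeakDerivOn Ω w.fst w.snd}
  add_mem' hv hw :=
    (hv.add hw (Lp.memLp _) (Lp.memLp _) (Lp.memLp _) (Lp.memLp _)).congr
      (Lp.coeFn_add _ _) (Lp.coeFn_add _ _)
  zero_mem' := hasWeakDerivOn_zero.congr (Lp.coeFn_zero _ _ _) (Lp.coeFn_zero _ _ _)
  smul_mem' a _ hw := (HasWeakDerivOn.smul hw a).congr (Lp.coeFn_smul _ _) (Lp.coeFn_smul _ _)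

/-- The Sobolev space `H¹(Ω)`. -/
def H1 (Ω : Set ℝ) : Type := H1Submodule Ω

instance (Ω : Set ℝ) : NormedAddCommGroup (H1 Ω) :=
  inferInstanceAs (NormedAddCommGroup (H1Submodule Ω))

instance (Ω : Set ℝ) : InnerProductSpace ℝ (H1 Ω) :=
  inferInstanceAs (InnerProductSpace ℝ (H1Submodule Ω))

/-- The underlying function in `L²(Ω)` of an element of `H¹(Ω)`. -/
def toL2 {Ω : Set ℝ} : H1 Ω →L[ℝ] L2 Ω :=
  (WithLp.fstL 2 ℝ (L2 Ω) (L2 Ω)).comp (H1Submodule Ω).subtypeL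

/-- The weak derivative of an element of `H¹(Ω)`. -/
def weakDeriv {Ω : Set ℝ} : H1 Ω →L[ℝ] L2 Ω :=
  (WithLp.sndL 2 ℝ (L2 Ω) (L2 Ω)).comp (H1Submodule Ω).subtypeL

/-- `H = L²(ℝ)`. -/
abbrev H : Type := L2 univ

/-- `V = H¹(ℝ)`. -/
abbrev V : Type := H1 univ

/-- The dual space of `V`, with the operator norm. -/
abbrev VDual : Type := StrongDual ℝ V

/-! ## Functions of time -/

/-- Lebesgue measure on the time interval `(0, T)`. -/
abbrev timeMeasure (T : ℝ) : Measure ℝ := volume.restrict (Ioo 0 T)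

theorem memLp_inner_toL2 {T : ℝ} (y : Lp V 2 (timeMeasure T)) (v : V) :
    MemLp (fun t => ⟪toL2 (y t), toL2 v⟫) 2 (timeMeasure T) := by
  let L : V →L[ℝ] ℝ := (innerSL ℝ (toL2 v)).comp (toL2 (Ω := univ))
  refine (L.comp_memLp' (Lp.memLp y)).ae_eq
    (Eventually.of_forall fun t => ?_)
  exact real_inner_comm (toL2 (y t)) (toL2 v)

theorem memLp_apply {T : ℝ} (g : Lp VDual 2 (timeMeasure T)) (v : V) :
    MemLp (fun t => g t v) 2 (timeMeasure T) :=
  (ContinuousLinearMap.apply ℝ ℝ v).comp_memLp' (Lp.memLp g)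

/-- The space `W(V) = {y ∈ L²(0,T;V) | ∂ₜy ∈ L²(0,T;V*)}`, as the space of pairs `(y, ∂ₜy)`. Here
`H` is identified with its dual, so that `∂ₜy = g` means that for every `v` in `V` the scalar
function `⟨y(t), v⟩_H` has the weak derivative `⟨g(t), v⟩_{V*,V}` on `(0, T)`. The squared norm is
`‖y‖²` in `L²(V)` plus `‖∂ₜy‖²` in `L²(V*)`. -/
def WSubmodule (T : ℝ) :
    Submodule ℝ (WithLp 2 (Lp V 2 (timeMeasure T) × Lp VDual 2 (timeMeasure T))) where
  carrier := {w | ∀ v : V, HasWeakDerivOn (Ioo 0 T)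
    (fun t => ⟪toL2 (w.fst t), toL2 v⟫) (fun t => w.snd t v)}
  add_mem' {y z} hy hz v := by
    refine ((hy v).add (hz v) (memLp_inner_toL2 _ v) (memLp_apply _ v) (memLp_inner_toL2 _ v)
      (memLp_apply _ v)).congr ?_ ?_
    · filter_upwards [Lp.coeFn_add y.fst z.fst] with t ht
      simp only [WithLp.add_fst, ht, Pi.add_apply]
      exact inner_add_left _ _ _
    · filter_upwards [Lp.coeFn_add y.snd z.snd] with t ht
      simp only [WithLp.add_snd, ht, Pi.add_apply, add_apply]
  zero_mem' v := by
    refine hasWeakDerivOn_zero.congr ?_ ?_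
    · filter_upwards [Lp.coeFn_zero V 2 (timeMeasure T)] with t ht
      simp only [WithLp.zero_fst, ht, Pi.zero_apply]
      exact inner_zero_left _
    · filter_upwards [Lp.coeFn_zero VDual 2 (timeMeasure T)] with t ht
      simp only [WithLp.zero_snd, ht, Pi.zero_apply, zero_apply]
  smul_mem' a y hy v := by
    refine ((hy v).smul a).congr ?_ ?_
    · filter_upwards [Lp.coeFn_smul a y.fst] with t ht
      simp only [WithLp.smul_fst, ht, Pi.smul_apply]
      exact real_inner_smul_left _ _ _
    · filter_upwards [Lp.coeFn_smul a y.snd] with t ht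
      simp only [WithLp.smul_snd, ht, Pi.smul_apply, smul_apply]

/-- The space `W(V)`. -/
def W (T : ℝ) : Type := WSubmodule T

instance (T : ℝ) : NormedAddCommGroup (W T) :=
  inferInstanceAs (NormedAddCommGroup (WSubmodule T))

instance (T : ℝ) : NormedSpace ℝ (W T) :=
  inferInstanceAs (NormedSpace ℝ (WSubmodule T))

/-- `y(t) ∈ V`, for almost every `t` in `(0, T)`. -/
def val {T : ℝ} (y : W T) : ℝ → V := y.1.fst

/-- `∂ₜy(t) ∈ V*`, for almost every `t` in `(0, T)`. -/
def timeDeriv {T : ℝ} (y : W T) : ℝ → VDual := y.1.snd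

/-- The function `f`, given almost everywhere on `(0, T)`, has a representative which is continuous
on `[0, T]` and takes the value `a` at `t`. (Used for `W(V) ⊆ C([0,T];H)` and
`H¹(0,T) ⊆ C([0,T])`.) -/
def HasValueAt {E : Type*} [TopologicalSpace E] (T : ℝ) (f : ℝ → E) (t : ℝ) (a : E) : Prop :=
  ∃ g : ℝ → E, ContinuousOn g (Icc 0 T) ∧ g =ᵐ[timeMeasure T] f ∧ g t = a

/-- `a ∈ H` is the value `y(t)` of `y ∈ W(V)` at the time `t ∈ [0, T]`. -/
def ValueAt {T : ℝ} (y : W T) (t : ℝ) (a : H) : Prop :=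
  HasValueAt T (fun s => toL2 (val y s)) t a

/-! ## The data of the control problem -/

/-- The function vanishes (almost everywhere) outside a bounded interval. -/
def HasBoundedSupport (f : H) : Prop :=
  ∃ a b : ℝ, ∀ᵐ x : ℝ, x ∉ Icc a b → f x = 0

/-- The admissible controls: `u ∈ H¹(0,T)` with `u_l ≤ u ≤ u_u` almost everywhere. -/
def admissible (T ul uu : ℝ) : Set (H1 (Ioo 0 T)) :=
  {u | ∀ᵐ t ∂(timeMeasure T), ul ≤ toL2 u t ∧ toL2 u t ≤ uu}

/-- `C_state = C (‖u‖_{L²(0,T)} + ‖y₀‖_V)² exp (C (‖u‖²_{L²(0,T)} + ‖y₀‖²_H))`. -/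
def stateConst {T : ℝ} (C : ℝ) (u : H1 (Ioo 0 T)) (y₀ : V) : ℝ :=
  C * (‖toL2 u‖ + ‖y₀‖) ^ 2 * Real.exp (C * (‖toL2 u‖ ^ 2 + ‖toL2 y₀‖ ^ 2))

/-! ## The particle discretisation -/

/-- A smooth kernel generating a Dirac sequence, with the moment conditions of order `r ≥ 1`. -/
structure IsKernel (r : ℕ) (ζ : ℝ → ℝ) : Prop where
  one_le : 1 ≤ r
  smooth : ContDiff ℝ ∞ ζ
  integrable : Integrable ζ
  integral_eq_one : ∫ x, ζ x = 1
  moment_eq_zero : ∀ k : ℕ, 1 ≤ k → k ≤ r - 1 → ∫ x, x ^ k * ζ x = 0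
  moment_integrable : Integrable fun x => |x| ^ r * |ζ x|

/-- `δ_ε(x) = ε⁻¹ ζ(ε⁻¹ x)`. -/
def mollifier (ζ : ℝ → ℝ) (ε x : ℝ) : ℝ := ε⁻¹ * ζ (ε⁻¹ * x)

/-- The particle sum `∑ᵢ αᵢ(t) δ_ε(x - Φᵢ(t))`, with weights and positions at a fixed time. -/
def particleSum {N : ℕ} (ζ : ℝ → ℝ) (ε : ℝ) (α Φ : Fin N → ℝ) (x : ℝ) : ℝ :=
  ∑ i, α i * mollifier ζ ε (x - Φ i)

/-- `(y, Φ) ∈ (W(V) ∩ L^∞(0,T;V)) × H¹(0,T)^N` solves the discrete state problem with control `u`,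
initial value `y₀` and initial particle positions `X`. -/
structure IsDiscreteState {N : ℕ} {T : ℝ} (ν : ℝ) (χ : ℝ → ℝ) (ζ : ℝ → ℝ) (ε : ℝ)
    (X : Fin N → ℝ) (y₀ : V) (u : H1 (Ioo 0 T)) (y : W T) (Φ : Fin N → H1 (Ioo 0 T)) : Prop where
  /-- `y ∈ L^∞(0,T;V)` -/
  memLp_top : MemLp (val y) ⊤ (timeMeasure T)
  /-- `y(x,t) = ∑ᵢ αᵢ(t) δ_ε(x - Φᵢ(t))` and `∂ₜΦᵢ(t) = y(Φᵢ(t),t)` -/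
  particle : ∃ α : Fin N → ℝ → ℝ, ∀ᵐ t ∂(timeMeasure T),
    (∀ᵐ x : ℝ, toL2 (val y t) x
      = particleSum ζ ε (fun i => α i t) (fun i => toL2 (Φ i) t) x) ∧
    ∀ j, weakDeriv (Φ j) t
      = particleSum ζ ε (fun i => α i t) (fun i => toL2 (Φ i) t) (toL2 (Φ j) t)
  /-- `Φᵢ(0) = Xᵢ` -/
  particle_init : ∀ i, HasValueAt T (toL2 (Φ i)) 0 (X i)
  /-- `⟨∂ₜy,φ⟩ + ⟨y ∂ₓy,φ⟩ + ν ⟨∂ₓy,∂ₓφ⟩ = ⟨χ u(t),φ⟩` for almost every `t` and all `φ ∈ V` -/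
  equation : ∀ᵐ t ∂(timeMeasure T), ∀ φ : V,
    timeDeriv y t φ + (∫ x, toL2 (val y t) x * weakDeriv (val y t) x * toL2 φ x)
      + ν * ⟪weakDeriv (val y t), weakDeriv φ⟫
      = toL2 u t * ∫ x, χ x * toL2 φ x
  /-- `⟨y(0),ψ⟩ = ⟨y₀,ψ⟩` for all `ψ ∈ H` -/
  init : ∃ y0 : H, ValueAt y 0 y0 ∧ ∀ ψ : H, ⟪y0, ψ⟫ = ⟪toL2 y₀, ψ⟫

/-- `p ∈ W(V)` solves the adjoint equation for the state `y`, where `yT = y(T)` and `yd` is the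
desired state. -/
structure IsDiscreteAdjoint {T : ℝ} (ν : ℝ) (yd yT : H) (y p : W T) : Prop where
  /-- `⟨∂ₜp,φ⟩ + ⟨y ∂ₓp,φ⟩ - ν ⟨∂ₓp,∂ₓφ⟩ = 0` for almost every `t` and all `φ ∈ V` -/
  equation : ∀ᵐ t ∂(timeMeasure T), ∀ φ : V,
    timeDeriv p t φ + (∫ x, toL2 (val y t) x * weakDeriv (val p t) x * toL2 φ x)
      - ν * ⟪weakDeriv (val p t), weakDeriv φ⟫ = 0
  /-- `⟨p(T),ψ⟩ = ⟨yd - y(T),ψ⟩` for all `ψ ∈ H` -/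
  terminal : ∃ pT : H, ValueAt p T pT ∧ ∀ ψ : H, ⟪pT, ψ⟫ = ⟪yd - yT, ψ⟫

end BurgersControl

end

/-!
The basic tool is the energy identity `‖Y(t)‖² - ‖Y(s)‖² = 2 ∫ₛᵗ ⟨∂ₜy, y⟩` for the continuous
representative `Y` of `y ∈ W(V)`. Convexity of `‖·‖²` bounds the increment of `∫ₛᵗ ‖Y‖²` under a
time shift `h` from below by a pairing with derivative `2 ∫ₛᵗ ⟨∂ₜy, y⟩` at `h = 0`; as `h` may have
either sign, the derivatives agree, and no mollification in time is needed.

Testing the Burgers equation with `y` kills the convection term, since `y² ∂ₓy` is an exact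
derivative, and bounds `sup_t ‖y(t)‖_H²` and `∫ ‖y‖_V²` by a multiple of `‖u‖² + ‖y₀‖_H²`. Testing
the adjoint equation with `p`, the embedding `|y| ≤ ‖y‖_V` and Young's inequality leave a backward
Grönwall inequality with rate `‖y(t)‖_V² / ν`, whose exponential is therefore at most
`exp (C₀ (‖u‖² + ‖y₀‖_H²))`. The equation also gives `‖∂ₜp‖_{V*} ≤ (ν + ‖y‖_H) ‖∂ₓp‖_H`. Finally
`C_state ≥ C δ² exp (C (‖u‖² + ‖y₀‖_H²))` absorbs the exponential into `C_state²`.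
-/

open scoped Topology

namespace BurgersControl

/-! ## Absolutely continuous functions and Grönwall's inequality -/

theorem absolutelyContinuousOnInterval_comp_lipschitzOnWith {X Y : Type*} [PseudoMetricSpace X]
    [PseudoMetricSpace Y] {f : ℝ → X} {φ : X → Y} {a b : ℝ} {K : NNReal} {s : Set X}
    (hφ : LipschitzOnWith K φ s) (hf : AbsolutelyContinuousOnInterval f a b)
    (hs : MapsTo f (uIcc a b) s) :
    AbsolutelyContinuousOnInterval (fun x => φ (f x)) a b := by
  rw [absolutelyContinuousOnInterval_iff] at hf ⊢
  intro ε hε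
  obtain ⟨δ, hδ, hsum⟩ := hf (ε / (K + 1)) (by positivity)
  refine ⟨δ, hδ, fun I hI hlt => ?_⟩
  calc ∑ i ∈ Finset.range I.1, dist (φ (f (I.2 i).1)) (φ (f (I.2 i).2))
      ≤ ∑ i ∈ Finset.range I.1, K * dist (f (I.2 i).1) (f (I.2 i).2) :=
        Finset.sum_le_sum fun i hi =>
          hφ.dist_le_mul _ (hs (hI.1 i hi).1) _ (hs (hI.1 i hi).2)
    _ = K * ∑ i ∈ Finset.range I.1, dist (f (I.2 i).1) (f (I.2 i).2) := by rw [Finset.mul_sum]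
    _ ≤ K * (ε / (K + 1)) := by gcongr; exact (hsum I hI hlt).le
    _ < (K + 1) * (ε / (K + 1)) := by gcongr; linarith
    _ = ε := by field

theorem absolutelyContinuousOnInterval_exp_comp {f : ℝ → ℝ} {a b : ℝ}
    (hf : AbsolutelyContinuousOnInterval f a b) :
    AbsolutelyContinuousOnInterval (fun x => Real.exp (f x)) a b := by
  obtain ⟨M, hM⟩ := hf.exists_bound
  have hexp : LipschitzOnWith (Real.exp M).toNNReal Real.exp (Iic M) := by
    refine Convex.lipschitzOnWith_of_nnnorm_deriv_le (fun x _ => Real.differentiableAt_exp)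
      (fun x hx => ?_) (convex_Iic M)
    rw [Real.deriv_exp, ← NNReal.coe_le_coe, Real.coe_toNNReal _ (Real.exp_pos M).le, coe_nnnorm,
      Real.norm_of_nonneg (Real.exp_pos x).le]
    exact Real.exp_le_exp.2 hx
  exact absolutelyContinuousOnInterval_comp_lipschitzOnWith hexp hf
    fun x hx => (le_abs_self _).trans (hM x hx)

theorem integral_eq_sub_of_absolutelyContinuousOnInterval {F g : ℝ → ℝ} {a b : ℝ}
    (hF : AbsolutelyContinuousOnInterval F a b)
    (hderiv : ∀ᵐ x, x ∈ uIcc a b → HasDerivAt F (g x) x) :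
    ∫ x in a..b, g x = F b - F a := by
  rw [← hF.integral_deriv_eq_sub]
  refine intervalIntegral.integral_congr_ae ?_
  filter_upwards [hderiv] with x hx hm
  exact (hx (uIoc_subset_uIcc hm)).deriv.symm

/-- With `Z t = A + ∫ r in t..b, β r * N r`, the function `t ↦ Z t * exp (-∫ r in t..b, β r)` has
the nonnegative derivative `β * (Z - N) * exp (-∫ r in t..b, β r)`. -/
theorem gronwall_backward {N β : ℝ → ℝ} {A a b : ℝ}
    (hN : ContinuousOn N (Icc a b)) (hβ : IntervalIntegrable β volume a b) (hβ0 : ∀ t, 0 ≤ β t)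
    (h : ∀ t ∈ Icc a b, N t ≤ A + ∫ r in t..b, β r * N r) {t : ℝ} (ht : t ∈ Icc a b) :
    A + ∫ r in t..b, β r * N r ≤ A * Real.exp (∫ r in t..b, β r) := by
  have hsub : uIcc t b ⊆ uIcc a b := uIcc_subset_uIcc_right (Icc_subset_uIcc ht)
  rw [← uIcc_of_le (ht.1.trans ht.2)] at hN
  have hβt := hβ.mono_set hsub
  have hβN := (hβ.mul_continuousOn hN).mono_set hsub
  have hZ : AbsolutelyContinuousOnInterval (fun x => A - ∫ r in b..x, β r * N r) t b :=
    (contDiff_const.contDiffOn (n := 1)).absolutelyContinuousOnInterval.sub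
      (hβN.absolutelyContinuousOnInterval_intervalIntegral right_mem_uIcc)
  have hE := absolutelyContinuousOnInterval_exp_comp
    (hβt.absolutelyContinuousOnInterval_intervalIntegral right_mem_uIcc)
  have key := integral_eq_sub_of_absolutelyContinuousOnInterval (hZ.mul hE)
    (g := fun x => -(β x * N x) * Real.exp (∫ r in b..x, β r) +
      (A - ∫ r in b..x, β r * N r) * (Real.exp (∫ r in b..x, β r) * β x)) (by
    filter_upwards [hβN.ae_hasDerivAt_integral, hβt.ae_hasDerivAt_integral] with x h₁ h₂ hx
    exact ((h₁ hx b right_mem_uIcc).const_sub A).mul (h₂ hx b right_mem_uIcc).exp)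
  have hnonneg : 0 ≤ ∫ x in t..b, (-(β x * N x) * Real.exp (∫ r in b..x, β r) +
      (A - ∫ r in b..x, β r * N r) * (Real.exp (∫ r in b..x, β r) * β x)) := by
    refine intervalIntegral.integral_nonneg ht.2 fun x hx => ?_
    have hNx := h x ⟨ht.1.trans hx.1, hx.2⟩
    rw [intervalIntegral.integral_symm b x] at hNx
    have := mul_nonneg (mul_nonneg (hβ0 x) (Real.exp_pos (∫ r in b..x, β r)).le)
      (sub_nonneg.2 hNx)
    linarith
  rw [key] at hnonneg
  simp only [Pi.mul_apply, intervalIntegral.integral_same, sub_zero, Real.exp_zero, mul_one,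
    intervalIntegral.integral_symm t b, sub_neg_eq_add, Real.exp_neg, sub_nonneg] at hnonneg
  rwa [← div_le_iff₀ (Real.exp_pos _)]

/-! ## Primitives and weak derivatives -/

theorem exists_subset_Ioo_of_isCompact {Ω K : Set ℝ} (hΩ : IsOpen Ω) (hΩc : OrdConnected Ω)
    (hK : IsCompact K) (hKΩ : K ⊆ Ω) (hne : K.Nonempty) :
    ∃ a b, K ⊆ Ioo a b ∧ Icc a b ⊆ Ω := by
  have hinf := hΩ.eventually_mem (hKΩ (hK.sInf_mem hne))
  have hsup := hΩ.eventually_mem (hKΩ (hK.sSup_mem hne))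
  obtain ⟨a, haΩ, ha⟩ := ((hinf.filter_mono nhdsWithin_le_nhds).and
    (eventually_mem_nhdsWithin (s := Iio (sInf K)))).exists
  obtain ⟨b, hbΩ, hb⟩ := ((hsup.filter_mono nhdsWithin_le_nhds).and
    (eventually_mem_nhdsWithin (s := Ioi (sSup K)))).exists
  exact ⟨a, b, fun x hx => ⟨ha.trans_le (csInf_le hK.bddBelow hx),
    (le_csSup hK.bddAbove hx).trans_lt hb⟩, hΩc.out haΩ hbΩ⟩

theorem integrableOn_mul_of_tsupport_subset {Ω : Set ℝ} {k φ : ℝ → ℝ}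
    (hk : LocallyIntegrableOn k Ω) (hφ : Continuous φ) (hc : HasCompactSupport φ)
    (hs : tsupport φ ⊆ Ω) : IntegrableOn (fun x => k x * φ x) Ω := by
  obtain ⟨C, hC⟩ := hφ.bounded_above_of_compact_support hc
  have hon : IntegrableOn (fun x => k x * φ x) (tsupport φ) :=
    (hk.integrableOn_compact_subset hs hc).mul_bdd hφ.aestronglyMeasurable (.of_forall hC)
  refine ((integrableOn_iff_integrable_of_support_subset ?_).1 hon).integrableOn
  exact (Function.support_mul_subset_right k φ).trans subset_closure

theorem intervalIntegrable_of_locallyIntegrableOn {Ω : Set ℝ} {g : ℝ → ℝ} {a b : ℝ}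
    (hΩc : OrdConnected Ω) (hg : LocallyIntegrableOn g Ω) (ha : a ∈ Ω) (hb : b ∈ Ω) :
    IntervalIntegrable g volume a b :=
  (intervalIntegrable_iff' (by simp)).2
    (hg.integrableOn_compact_subset (hΩc.uIcc_subset ha hb) isCompact_uIcc)

theorem continuousAt_primitive {Ω : Set ℝ} {g : ℝ → ℝ} {x₀ x : ℝ} (hΩ : IsOpen Ω)
    (hΩc : OrdConnected Ω) (hg : LocallyIntegrableOn g Ω) (hx₀ : x₀ ∈ Ω) (hx : x ∈ Ω) :
    ContinuousAt (fun x => ∫ t in x₀..x, g t) x := by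
  obtain ⟨a, b, hK, hab⟩ := exists_subset_Ioo_of_isCompact hΩ hΩc (K := {x₀, x})
    (finite_insert.2 (finite_singleton x)).isCompact (pair_subset hx₀ hx) (insert_nonempty _ _)
  obtain ⟨hx₀ab, hxab⟩ := pair_subset_iff.1 hK
  have hle : a ≤ b := (hx₀ab.1.trans hx₀ab.2).le
  have hgi : IntervalIntegrable g volume a b := intervalIntegrable_of_locallyIntegrableOn hΩc hg
    (hab (left_mem_Icc.2 hle)) (hab (right_mem_Icc.2 hle))
  have hcont := intervalIntegral.continuousOn_primitive_interval' hgi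
    (Icc_subset_uIcc (Ioo_subset_Icc_self hx₀ab))
  rw [uIcc_of_le hle] at hcont
  exact hcont.continuousAt (Icc_mem_nhds hxab.1 hxab.2)

theorem setIntegral_mul_eq_intervalIntegral {Ω : Set ℝ} {φ k : ℝ → ℝ} {a b : ℝ}
    (hφ : tsupport φ ⊆ Ioo a b) (hab : Ioo a b ⊆ Ω) :
    ∫ x in Ω, k x * φ x = ∫ x in a..b, k x * φ x := by
  have hzero : ∀ s : Set ℝ, Ioo a b ⊆ s → ∫ x in s, k x * φ x = ∫ x, k x * φ x := fun s hs =>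
    setIntegral_eq_integral_of_forall_compl_eq_zero fun x hx => by
      rw [image_eq_zero_of_notMem_tsupport fun hx' => hx (hs (hφ hx')), mul_zero]
  rcases (Ioo a b).eq_empty_or_nonempty with he | ⟨c, hc⟩
  · have : φ = 0 := tsupport_eq_empty_iff.1 (subset_empty_iff.1 (he ▸ hφ))
    simp [this]
  · rw [intervalIntegral.integral_of_le (hc.1.trans hc.2).le, integral_Ioc_eq_integral_Ioo,
      hzero _ hab, hzero _ subset_rfl]

theorem hasWeakDerivOn_primitive {Ω : Set ℝ} {g : ℝ → ℝ} {x₀ : ℝ} (hΩ : IsOpen Ω)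
    (hΩc : OrdConnected Ω) (hg : LocallyIntegrableOn g Ω) (hx₀ : x₀ ∈ Ω) :
    HasWeakDerivOn Ω (fun x => ∫ t in x₀..x, g t) g := by
  intro φ hφ hc hs
  obtain ⟨a, b, hK, hab⟩ := exists_subset_Ioo_of_isCompact hΩ hΩc (hc.isCompact.insert x₀)
    (insert_subset hx₀ hs) (insert_nonempty _ _)
  obtain ⟨hx₀ab, hφab⟩ := insert_subset_iff.1 hK
  have hle : a ≤ b := (hx₀ab.1.trans hx₀ab.2).le
  have hφa : φ a = 0 := image_eq_zero_of_notMem_tsupport fun h => lt_irrefl _ (hφab h).1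
  have hφb : φ b = 0 := image_eq_zero_of_notMem_tsupport fun h => lt_irrefl _ (hφab h).2
  have hgi : IntervalIntegrable g volume a b := intervalIntegrable_of_locallyIntegrableOn hΩc hg
    (hab (left_mem_Icc.2 hle)) (hab (right_mem_Icc.2 hle))
  have hx₀u : x₀ ∈ uIcc a b := Icc_subset_uIcc (Ioo_subset_Icc_self hx₀ab)
  have parts :=
    (hgi.absolutelyContinuousOnInterval_intervalIntegral hx₀u).integral_mul_deriv_eq_deriv_mul
      ((hφ.of_le (by simp)).contDiffOn (n := 1)).absolutelyContinuousOnInterval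
  have hderiv : ∫ x in a..b, deriv (fun x => ∫ t in x₀..x, g t) x * φ x
      = ∫ x in a..b, g x * φ x := by
    refine intervalIntegral.integral_congr_ae ?_
    filter_upwards [hgi.ae_hasDerivAt_integral] with x hx hm
    rw [(hx (uIoc_subset_uIcc hm) x₀ hx₀u).deriv]
  rw [setIntegral_mul_eq_intervalIntegral (tsupport_deriv_subset.trans hφab)
    (Ioo_subset_Icc_self.trans hab), setIntegral_mul_eq_intervalIntegral hφab
    (Ioo_subset_Icc_self.trans hab), parts, hφa, hφb, hderiv]
  ring

theorem tsupport_primitive_subset_Icc {η : ℝ → ℝ} {a b : ℝ} (hη : tsupport η ⊆ Ioo a b)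
    (h0 : ∫ x, η x = 0) : tsupport (fun x => ∫ t in a..x, η t) ⊆ Icc a b := by
  have hzero : ∀ x, x ∉ Ioo a b → η x = 0 := fun x hx =>
    image_eq_zero_of_notMem_tsupport fun h => hx (hη h)
  refine closure_minimal (fun x hx => ?_) isClosed_Icc
  by_contra hn
  apply hx
  rcases lt_or_ge x a with hxa | hax
  · refine intervalIntegral.integral_zero_ae (.of_forall fun t ht => hzero t fun h => ?_)
    rw [uIoc_of_ge hxa.le] at ht
    exact ht.2.not_gt h.1
  · have hbx : b < x := lt_of_not_ge fun hxb => hn ⟨hax, hxb⟩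
    change ∫ t in a..x, η t = 0
    rw [intervalIntegral.integral_of_le hax, setIntegral_eq_integral_of_forall_compl_eq_zero, h0]
    exact fun t ht => hzero t fun h => ht ⟨h.1, h.2.le.trans hbx.le⟩

theorem exists_deriv_eq_of_integral_eq_zero {Ω : Set ℝ} {η : ℝ → ℝ} (hΩ : IsOpen Ω)
    (hΩc : OrdConnected Ω) (hη : ContDiff ℝ ∞ η) (hc : HasCompactSupport η) (hs : tsupport η ⊆ Ω)
    (h0 : ∫ x, η x = 0) :
    ∃ Θ : ℝ → ℝ, ContDiff ℝ ∞ Θ ∧ HasCompactSupport Θ ∧ tsupport Θ ⊆ Ω ∧ deriv Θ = η := by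
  rcases (tsupport η).eq_empty_or_nonempty with he | hne
  · exact ⟨0, contDiff_const, .zero, by simp, by simp [tsupport_eq_empty_iff.1 he]⟩
  obtain ⟨a, b, hK, hab⟩ := exists_subset_Ioo_of_isCompact hΩ hΩc hc hs hne
  have hderiv : ∀ x, HasDerivAt (fun x => ∫ t in a..x, η t) (η x) x := fun x =>
    intervalIntegral.integral_hasDerivAt_right (hη.continuous.intervalIntegrable _ _)
      (hη.continuous.stronglyMeasurableAtFilter _ _) hη.continuous.continuousAt
  have hderiv_eq : deriv (fun x => ∫ t in a..x, η t) = η := funext fun x => (hderiv x).deriv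
  have hsupp := tsupport_primitive_subset_Icc hK h0
  refine ⟨fun x => ∫ t in a..x, η t, contDiff_infty_iff_deriv.2
    ⟨fun x => (hderiv x).differentiableAt, by rwa [hderiv_eq]⟩, ?_, hsupp.trans hab, hderiv_eq⟩
  exact isCompact_Icc.of_isClosed_subset (isClosed_tsupport _) hsupp

theorem exists_contDiff_tsupport_subset_integral_eq_one {Ω : Set ℝ} (hΩ : IsOpen Ω)
    (hne : Ω.Nonempty) :
    ∃ ψ : ℝ → ℝ, ContDiff ℝ ∞ ψ ∧ HasCompactSupport ψ ∧ tsupport ψ ⊆ Ω ∧ ∫ x, ψ x = 1 := by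
  obtain ⟨x₀, hx₀⟩ := hne
  obtain ⟨f, hfΩ, hfc, hf, hf01, hfx₀⟩ :=
    exists_contDiff_tsupport_subset (n := ⊤) (hΩ.mem_nhds hx₀)
  have hpos : 0 < ∫ x, f x := hf.continuous.integral_pos_of_hasCompactSupport_nonneg_nonzero hfc
    (fun x => (hf01 (mem_range_self x)).1) (x := x₀) (by rw [hfx₀]; exact one_ne_zero)
  refine ⟨fun x => (∫ x, f x)⁻¹ * f x, contDiff_const.mul hf, hfc.mul_left,
    tsupport_mul_subset_right.trans hfΩ, ?_⟩
  rw [integral_const_mul, inv_mul_cancel₀ hpos.ne']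

theorem HasWeakDerivOn.integral_mul_eq_mul_integral {Ω : Set ℝ} {f φ ψ : ℝ → ℝ}
    (hΩ : IsOpen Ω) (hΩc : OrdConnected Ω) (h : HasWeakDerivOn Ω f 0)
    (hf : LocallyIntegrableOn f Ω) (hψ : ContDiff ℝ ∞ ψ) (hψc : HasCompactSupport ψ)
    (hψs : tsupport ψ ⊆ Ω) (hψ1 : ∫ x, ψ x = 1)
    (hφ : ContDiff ℝ ∞ φ) (hφc : HasCompactSupport φ) (hφs : tsupport φ ⊆ Ω) :
    ∫ x in Ω, f x * φ x = (∫ x in Ω, f x * ψ x) * ∫ x, φ x := by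
  set m := ∫ x, φ x
  obtain ⟨Θ, hΘ, hΘc, hΘs, hΘd⟩ := exists_deriv_eq_of_integral_eq_zero hΩ hΩc
    (η := fun x => φ x - m * ψ x) (hφ.sub (contDiff_const.mul hψ)) (hφc.sub hψc.mul_left)
    ((tsupport_sub φ fun x => m * ψ x).trans
      (union_subset hφs (tsupport_mul_subset_right.trans hψs))) (by
    rw [integral_sub (hφ.continuous.integrable_of_hasCompactSupport hφc)
      ((hψ.continuous.integrable_of_hasCompactSupport hψc).const_mul m), integral_const_mul,
      hψ1, mul_one, sub_self])
  have hΘ0 := h Θ hΘ hΘc hΘs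
  have hexpand : ∀ x, f x * (φ x - m * ψ x) = f x * φ x - m * (f x * ψ x) := fun x => by ring
  simp only [hΘd, hexpand, Pi.zero_apply, zero_mul, integral_zero, neg_zero] at hΘ0
  rw [integral_sub (integrableOn_mul_of_tsupport_subset hf hφ.continuous hφc hφs)
    ((integrableOn_mul_of_tsupport_subset hf hψ.continuous hψc hψs).const_mul m),
    integral_const_mul] at hΘ0
  linarith

theorem HasWeakDerivOn.exists_ae_eq_const {Ω : Set ℝ} {f : ℝ → ℝ} (hΩ : IsOpen Ω)
    (hΩc : OrdConnected Ω) (hne : Ω.Nonempty) (hf : LocallyIntegrableOn f Ω)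
    (h : HasWeakDerivOn Ω f 0) : ∃ c : ℝ, ∀ᵐ x ∂(volume.restrict Ω), f x = c := by
  obtain ⟨ψ, hψ, hψc, hψs, hψ1⟩ := exists_contDiff_tsupport_subset_integral_eq_one hΩ hne
  set c := ∫ x in Ω, f x * ψ x
  have hconst : LocallyIntegrableOn (fun _ : ℝ => c) Ω :=
    locallyIntegrable_const c |>.locallyIntegrableOn _
  have hzero := hΩ.ae_eq_zero_of_integral_contDiff_smul_eq_zero (μ := volume)
    (f := fun x => f x - c) (hf.sub hconst) (by
    intro φ hφ hφc hφs
    have hφΩ : ∫ x in Ω, φ x = ∫ x, φ x := setIntegral_eq_integral_of_forall_compl_eq_zero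
      fun x hx => image_eq_zero_of_notMem_tsupport fun hx' => hx (hφs hx')
    have hswap : ∀ x, φ x • (f x - c) = f x * φ x - c * φ x := fun x => by
      rw [smul_eq_mul]; ring
    rw [← setIntegral_eq_integral_of_forall_compl_eq_zero (s := Ω) (fun x hx => by
      rw [image_eq_zero_of_notMem_tsupport fun hx' => hx (hφs hx'), zero_smul])]
    simp only [hswap]
    rw [integral_sub (integrableOn_mul_of_tsupport_subset hf hφ.continuous hφc hφs)
      (integrableOn_mul_of_tsupport_subset hconst hφ.continuous hφc hφs), integral_const_mul, hφΩ,
      h.integral_mul_eq_mul_integral hΩ hΩc hf hψ hψc hψs hψ1 hφ hφc hφs, sub_self])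
  refine ⟨c, (ae_restrict_iff' hΩ.measurableSet).2 ?_⟩
  filter_upwards [hzero] with x hx hxΩ
  exact sub_eq_zero.1 (hx hxΩ)

theorem HasWeakDerivOn.exists_ae_eq_add_integral {Ω : Set ℝ} {f g : ℝ → ℝ} {x₀ : ℝ}
    (hΩ : IsOpen Ω) (hΩc : OrdConnected Ω) (hx₀ : x₀ ∈ Ω) (hf : LocallyIntegrableOn f Ω)
    (hg : LocallyIntegrableOn g Ω) (h : HasWeakDerivOn Ω f g) :
    ∃ c : ℝ, ∀ᵐ x ∂(volume.restrict Ω), f x = c + ∫ t in x₀..x, g t := by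
  have hprim := hasWeakDerivOn_primitive hΩ hΩc hg hx₀
  have hG : LocallyIntegrableOn (fun x => ∫ t in x₀..x, g t) Ω := by
    refine ContinuousOn.locallyIntegrableOn (fun x hx => ?_) hΩ.measurableSet
    exact (continuousAt_primitive hΩ hΩc hg hx₀ hx).continuousWithinAt
  have hsub : HasWeakDerivOn Ω (fun x => f x - ∫ t in x₀..x, g t) 0 := by
    intro φ hφ hφc hφs
    have hφ' := hφ.continuous_deriv (by simp)
    have hφs' := tsupport_deriv_subset.trans hφs
    simp only [sub_mul, Pi.zero_apply, zero_mul, integral_zero, neg_zero]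
    rw [integral_sub (integrableOn_mul_of_tsupport_subset hf hφ' hφc.deriv hφs')
      (integrableOn_mul_of_tsupport_subset hG hφ' hφc.deriv hφs'), h φ hφ hφc hφs,
      hprim φ hφ hφc hφs, sub_self]
  obtain ⟨c, hc⟩ := hsub.exists_ae_eq_const hΩ hΩc ⟨x₀, hx₀⟩ (hf.sub hG)
  refine ⟨c, ?_⟩
  filter_upwards [hc] with x hx
  exact sub_eq_iff_eq_add.1 hx

/-! ## The space `H¹(ℝ)` -/

section IntegrablePrimitive

variable {F g : ℝ → ℝ}

theorem tendsto_atTop_zero_of_integrable_primitive (hF : Integrable F) (hg : Integrable g)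
    (h : ∀ a b, ∫ x in a..b, g x = F b - F a) : Tendsto F atTop (𝓝 0) := by
  have hlim := (intervalIntegral_tendsto_integral_Ioi 0 hg.integrableOn tendsto_id).const_add (F 0)
  simp only [h, id, add_sub_cancel] at hlim
  have hzero := (hF.integrableAtFilter atTop).eq_zero_of_tendsto
    (fun s hs => by
      obtain ⟨a, ha⟩ := mem_atTop_sets.1 hs
      exact measure_eq_top_mono (s := Ici a) ha Real.volume_Ici) hlim
  rwa [hzero] at hlim

theorem tendsto_atBot_zero_of_integrable_primitive (hF : Integrable F) (hg : Integrable g)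
    (h : ∀ a b, ∫ x in a..b, g x = F b - F a) : Tendsto F atBot (𝓝 0) := by
  have hlim := (intervalIntegral_tendsto_integral_Iic 0 hg.integrableOn tendsto_id).const_sub (F 0)
  simp only [h, id, sub_sub_cancel] at hlim
  have hzero := (hF.integrableAtFilter atBot).eq_zero_of_tendsto
    (fun s hs => by
      obtain ⟨a, ha⟩ := mem_atBot_sets.1 hs
      exact measure_eq_top_mono (s := Iic a) ha Real.volume_Iic) hlim
  rwa [hzero] at hlim

theorem setIntegral_Iic_eq_of_integrable_primitive (hF : Integrable F) (hg : Integrable g)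
    (h : ∀ a b, ∫ x in a..b, g x = F b - F a) (x : ℝ) : ∫ t in Iic x, g t = F x := by
  have hlim := intervalIntegral_tendsto_integral_Iic x hg.integrableOn tendsto_id
  simp only [h, id] at hlim
  simpa using tendsto_nhds_unique hlim
    ((tendsto_atBot_zero_of_integrable_primitive hF hg h).const_sub (F x))

theorem integral_eq_zero_of_integrable_primitive (hF : Integrable F) (hg : Integrable g)
    (h : ∀ a b, ∫ x in a..b, g x = F b - F a) : ∫ x, g x = 0 := by
  have hlim := (intervalIntegral_tendsto_integral_Ioi 0 hg.integrableOn tendsto_id)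
  simp only [h, id] at hlim
  have hIoi := tendsto_nhds_unique hlim
    ((tendsto_atTop_zero_of_integrable_primitive hF hg h).sub_const (F 0))
  rw [← intervalIntegral.integral_Iic_add_Ioi hg.integrableOn hg.integrableOn (b := 0), hIoi,
    setIntegral_Iic_eq_of_integrable_primitive hF hg h]
  ring

theorem abs_le_integral_abs_of_integrable_primitive (hF : Integrable F) (hg : Integrable g)
    (h : ∀ a b, ∫ x in a..b, g x = F b - F a) (x : ℝ) : |F x| ≤ ∫ t, |g t| := by
  rw [← setIntegral_Iic_eq_of_integrable_primitive hF hg h x]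
  exact abs_integral_le_integral_abs.trans
    (setIntegral_le_integral hg.abs (.of_forall fun t => abs_nonneg (g t)))

end IntegrablePrimitive

theorem Lp_norm_sq_eq_integral {α E : Type*} [MeasurableSpace α] [NormedAddCommGroup E]
    {μ : Measure α} (f : Lp E 2 μ) : ‖f‖ ^ 2 = ∫ x, ‖f x‖ ^ 2 ∂μ := by
  have h := (Lp.memLp f).eLpNorm_eq_integral_rpow_norm (by simp) (by simp)
  simp only [ENNReal.toReal_ofNat, Real.rpow_ofNat] at h
  have hnonneg : 0 ≤ ∫ x, ‖f x‖ ^ 2 ∂μ := integral_nonneg fun x => by positivity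
  rw [Lp.norm_def, h, ENNReal.toReal_ofReal (by positivity), ← Real.rpow_natCast,
    ← Real.rpow_mul hnonneg]
  norm_num

theorem integral_mul_eq_inner {α : Type*} [MeasurableSpace α] {μ : Measure α} (f g : Lp ℝ 2 μ) :
    ∫ x, f x * g x ∂μ = ⟪f, g⟫ := by
  simp [L2.inner_def, mul_comm]

theorem abs_integral_mul_mul_le {α : Type*} [MeasurableSpace α] {μ : Measure α} {φ : α → ℝ} {M : ℝ}
    (hφm : AEStronglyMeasurable φ μ) (hφ : ∀ᵐ x ∂μ, |φ x| ≤ M) (f g : Lp ℝ 2 μ) :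
    |∫ x, φ x * f x * g x ∂μ| ≤ M * ‖f‖ * ‖g‖ := by
  have hφf : MemLp (fun x => φ x * f x) 2 μ :=
    (Lp.memLp f).mul (memLp_top_of_bound hφm M hφ)
  have heq : ∫ x, φ x * f x * g x ∂μ = ⟪hφf.toLp, g⟫ := by
    rw [← integral_mul_eq_inner]
    refine integral_congr_ae ?_
    filter_upwards [hφf.coeFn_toLp] with x hx
    rw [hx]
  have hnorm : ‖hφf.toLp‖ ≤ M * ‖f‖ := by
    refine Lp.norm_le_mul_norm_of_ae_le_mul ?_
    filter_upwards [hφf.coeFn_toLp, hφ] with x hx hxM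
    rw [hx, norm_mul]
    gcongr
    exact hxM
  rw [heq]
  exact (abs_real_inner_le_norm _ _).trans (by gcongr)

theorem abs_integral_mul_le {α : Type*} [MeasurableSpace α] {μ : Measure α} {χ : α → ℝ}
    (hχ : MemLp χ 2 μ) (f : Lp ℝ 2 μ) : |∫ x, χ x * f x ∂μ| ≤ ‖hχ.toLp‖ * ‖f‖ := by
  have heq : ∫ x, χ x * f x ∂μ = ⟪hχ.toLp, f⟫ := by
    rw [← integral_mul_eq_inner]
    refine integral_congr_ae ?_
    filter_upwards [hχ.coeFn_toLp] with x hx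
    rw [hx]
  rw [heq]
  exact abs_real_inner_le_norm _ _

theorem hasWeakDerivOn_toL2 {Ω : Set ℝ} (φ : H1 Ω) : HasWeakDerivOn Ω (toL2 φ) (weakDeriv φ) :=
  (show H1Submodule Ω from φ).2

theorem H1.norm_sq_eq {Ω : Set ℝ} (φ : H1 Ω) : ‖φ‖ ^ 2 = ‖toL2 φ‖ ^ 2 + ‖weakDeriv φ‖ ^ 2 :=
  WithLp.prod_norm_sq_eq_of_L2 (show H1Submodule Ω from φ).1

theorem norm_weakDeriv_le {Ω : Set ℝ} (φ : H1 Ω) : ‖weakDeriv φ‖ ≤ ‖φ‖ :=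
  le_of_sq_le_sq (by rw [H1.norm_sq_eq φ]; linarith [sq_nonneg ‖toL2 φ‖]) (norm_nonneg φ)

theorem memLp_L2_univ (f : L2 univ) : MemLp f 2 volume := by
  simpa only [Measure.restrict_univ] using Lp.memLp f

theorem locallyIntegrable_L2_univ (f : L2 univ) : LocallyIntegrable f volume :=
  (memLp_L2_univ f).locallyIntegrable (by norm_num)

theorem integrable_mul_L2_univ (f g : L2 univ) : Integrable fun x => f x * g x :=
  (memLp_L2_univ f).integrable_mul (memLp_L2_univ g)

theorem exists_absolutelyContinuousOnInterval_ae_eq (φ : H1 univ) :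
    ∃ F : ℝ → ℝ, (∀ a b, AbsolutelyContinuousOnInterval F a b) ∧
      (∀ᵐ x, HasDerivAt F (weakDeriv φ x) x) ∧ ∀ᵐ x, toL2 φ x = F x := by
  have hloc := locallyIntegrable_L2_univ (weakDeriv φ)
  obtain ⟨c, hc⟩ := (hasWeakDerivOn_toL2 φ).exists_ae_eq_add_integral isOpen_univ ordConnected_univ
    (mem_univ 0) ((locallyIntegrable_L2_univ (toL2 φ)).locallyIntegrableOn _)
    (hloc.locallyIntegrableOn _)
  refine ⟨fun x => c + ∫ t in (0 : ℝ)..x, weakDeriv φ t, fun a b => ?_, ?_,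
    by simpa only [Measure.restrict_univ] using hc⟩
  · have hint : IntervalIntegrable (weakDeriv φ) volume (min 0 (min a b)) (max 0 (max a b)) :=
      intervalIntegrable_of_locallyIntegrableOn ordConnected_univ (hloc.locallyIntegrableOn _)
        (mem_univ _) (mem_univ _)
    exact (contDiff_const.contDiffOn (n := 1)).absolutelyContinuousOnInterval.add
      ((hint.absolutelyContinuousOnInterval_intervalIntegral (by simp)).mono
        (uIcc_subset_uIcc (by simp) (by simp)))
  · filter_upwards [LocallyIntegrable.ae_hasDerivAt_integral hloc] with x hx
    exact (hx 0).const_add c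

/-- Apply `|F| ≤ ∫ |F'|` to `F = φ ^ 2`, where `|F'| = |2 φ φ'| ≤ φ ^ 2 + φ' ^ 2`. -/
theorem ae_abs_toL2_le_norm (φ : H1 univ) : ∀ᵐ x, |toL2 φ x| ≤ ‖φ‖ := by
  obtain ⟨F, hac, hderiv, hF⟩ := exists_absolutelyContinuousOnInterval_ae_eq φ
  have hFF : ∀ a b, ∫ x in a..b, (weakDeriv φ x * F x + F x * weakDeriv φ x)
      = F b * F b - F a * F a := fun a b =>
    integral_eq_sub_of_absolutelyContinuousOnInterval ((hac a b).fun_mul (hac a b))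
      (hderiv.mono fun x hx _ => hx.mul hx)
  have hsq : Integrable fun x => F x * F x :=
    (integrable_mul_L2_univ (toL2 φ) (toL2 φ)).congr (hF.mono fun x hx => by simp only [hx])
  have hint : Integrable fun x => weakDeriv φ x * F x + F x * weakDeriv φ x :=
    ((integrable_mul_L2_univ (weakDeriv φ) (toL2 φ)).add
      (integrable_mul_L2_univ (toL2 φ) (weakDeriv φ))).congr
      (hF.mono fun x hx => by simp only [Pi.add_apply, hx])
  have hbound : ∫ x, |weakDeriv φ x * F x + F x * weakDeriv φ x| ≤ ‖φ‖ ^ 2 := by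
    rw [H1.norm_sq_eq, ← real_inner_self_eq_norm_sq, ← real_inner_self_eq_norm_sq,
      ← integral_mul_eq_inner, ← integral_mul_eq_inner, setIntegral_univ, setIntegral_univ,
      ← integral_add (integrable_mul_L2_univ _ _) (integrable_mul_L2_univ _ _)]
    refine integral_mono_ae hint.abs
      ((integrable_mul_L2_univ _ _).add (integrable_mul_L2_univ _ _)) ?_
    filter_upwards [hF] with x hx
    simp only [← hx, abs_le]
    constructor <;>
      nlinarith [sq_nonneg (toL2 φ x + weakDeriv φ x), sq_nonneg (toL2 φ x - weakDeriv φ x)]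
  filter_upwards [hF] with x hx
  refine abs_le_of_sq_le_sq ?_ (norm_nonneg φ)
  rw [hx, sq]
  exact (le_abs_self _).trans
    ((abs_le_integral_abs_of_integrable_primitive hsq hint hFF x).trans hbound)

theorem integrable_mul_mul_toL2 (φ : H1 univ) (f g : L2 univ) :
    Integrable fun x => toL2 φ x * (f x * g x) :=
  (integrable_mul_L2_univ f g).bdd_mul (memLp_L2_univ (toL2 φ)).1 (ae_abs_toL2_le_norm φ)

theorem abs_integral_toL2_mul_mul_le (φ : H1 univ) (f g : L2 univ) :
    |∫ x, toL2 φ x * f x * g x| ≤ ‖φ‖ * ‖f‖ * ‖g‖ := by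
  simpa only [setIntegral_univ] using abs_integral_mul_mul_le (Lp.memLp (toL2 φ)).1
    (by simpa only [Measure.restrict_univ] using ae_abs_toL2_le_norm φ) f g

/-- The integrand is the derivative of `φ ^ 3 / 3`, and `φ ^ 3` is integrable since `φ` is
bounded. -/
theorem integral_toL2_mul_weakDeriv_mul_toL2 (φ : H1 univ) :
    ∫ x, toL2 φ x * weakDeriv φ x * toL2 φ x = 0 := by
  obtain ⟨F, hac, hderiv, hF⟩ := exists_absolutelyContinuousOnInterval_ae_eq φ
  have hFFF : ∀ a b, ∫ x in a..b, 3 * (F x * (weakDeriv φ x * F x))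
      = F b * (F b * F b) - F a * (F a * F a) := fun a b =>
    integral_eq_sub_of_absolutelyContinuousOnInterval
      ((hac a b).fun_mul ((hac a b).fun_mul (hac a b)))
      (hderiv.mono fun x hx _ =>
        (hx.mul (hx.mul hx)).congr_deriv (by simp only [Pi.mul_apply]; ring))
  have hcube : Integrable fun x => F x * (F x * F x) :=
    (integrable_mul_mul_toL2 φ (toL2 φ) (toL2 φ)).congr (hF.mono fun x hx => by simp only [hx])
  have hint : Integrable fun x => 3 * (F x * (weakDeriv φ x * F x)) :=
    ((integrable_mul_mul_toL2 φ (weakDeriv φ) (toL2 φ)).congr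
      (hF.mono fun x hx => by simp only [hx])).const_mul 3
  have hzero := integral_eq_zero_of_integrable_primitive hcube hint hFFF
  rw [integral_const_mul, mul_eq_zero_iff_left three_ne_zero] at hzero
  rw [← hzero]
  refine integral_congr_ae (hF.mono fun x hx => ?_)
  simp only [hx, mul_assoc]

/-! ## The energy identity -/

section TranslatePairing

variable {E : Type*} [NormedAddCommGroup E] [NormedSpace ℝ E]

theorem integrable_apply_of_memLp_two {α : Type*} [MeasurableSpace α] {μ : Measure α}
    {a : α → StrongDual ℝ E} {b : α → E} (ha : MemLp a 2 μ) (hb : MemLp b 2 μ) :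
    Integrable (fun t => a t (b t)) μ :=
  memLp_one_iff_integrable.1
    ((ContinuousLinearMap.id ℝ (StrongDual ℝ E)).memLp_of_bilin 1 ha hb)

variable {a : ℝ → StrongDual ℝ E} {b : ℝ → E}

theorem continuous_integral_translate_apply (ha : MemLp a 2 volume) (hb : MemLp b 2 volume) :
    Continuous fun σ : ℝ => ∫ t, a (σ + t) (b t) := by
  let pairing := (ContinuousLinearMap.id ℝ (StrongDual ℝ E)).lpPairing (volume : Measure ℝ) 2 2
  let translate : ℝ → C(ℝ, ℝ) := fun σ => ⟨fun t => σ + t, by fun_prop⟩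
  have htranslate : Continuous translate :=
    ContinuousMap.continuous_of_continuous_uncurry _
      (show Continuous fun p : ℝ × ℝ => p.1 + p.2 by fun_prop)
  have hmp : ∀ σ, MeasurePreserving (translate σ) volume volume := fun σ =>
    measurePreserving_add_left volume σ
  have hcont : Continuous fun σ => Lp.compMeasurePreserving (translate σ) (hmp σ) ha.toLp :=
    Continuous.compMeasurePreservingLp (continuous_const (y := ha.toLp)) htranslate hmp (by simp)
  have heq : (fun σ : ℝ => ∫ t, a (σ + t) (b t)) = fun σ =>
      pairing (Lp.compMeasurePreserving (translate σ) (hmp σ) ha.toLp) hb.toLp := by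
    ext σ
    rw [ContinuousLinearMap.lpPairing_eq_integral]
    refine integral_congr_ae ?_
    filter_upwards [Lp.coeFn_compMeasurePreserving ha.toLp (hmp σ), hb.coeFn_toLp,
      (hmp σ).quasiMeasurePreserving.ae ha.coeFn_toLp] with t hshift hbt hat
    rw [hshift, hbt, Function.comp_apply, hat]
    rfl
  rw [heq]
  exact (pairing.flip hb.toLp).continuous.comp hcont

theorem integrable_prod_translate_apply (ha : MemLp a 2 volume) (hb : MemLp b 2 volume)
    (μ : Measure ℝ) [IsFiniteMeasure μ] :
    Integrable (fun z : ℝ × ℝ => a (z.1 + z.2) (b z.2)) (μ.prod volume) :=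
  integrable_apply_of_memLp_two
    ((ha.comp_snd μ).comp_measurePreserving (measurePreserving_prod_add μ volume)) (hb.comp_snd μ)

end TranslatePairing

theorem hasDerivAt_integral_comp_add {N : ℝ → ℝ} (hN : Continuous N) (s τ : ℝ) :
    HasDerivAt (fun h => ∫ t in s..τ, N (t + h)) (N τ - N s) 0 := by
  have hprim : ∀ x, HasDerivAt (fun h => ∫ t in (0 : ℝ)..(x + h), N t) (N x) 0 := fun x =>
    HasDerivAt.comp_const_add x 0
      (by simpa using (hN.integral_hasStrictDerivAt 0 x).hasDerivAt)
  refine ((hprim τ).sub (hprim s)).congr_of_eventuallyEq (.of_forall fun h => ?_)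
  simp only [intervalIntegral.integral_comp_add_right, Pi.sub_apply]
  exact (intervalIntegral.integral_interval_sub_left
    (hN.intervalIntegrable _ _) (hN.intervalIntegrable _ _)).symm

/-- The difference of the two sides of `hle` is minimal at `h = 0`, so its derivative vanishes. -/
theorem sub_eq_of_forall_integral_le {N D : ℝ → ℝ} (hN : Continuous N) (hD : Continuous D)
    {s τ : ℝ} (hle : ∀ h, ∫ σ in (0 : ℝ)..h, D σ ≤ ∫ t in s..τ, (N (t + h) - N t)) :
    N τ - N s = D 0 := by
  have hderiv := (hasDerivAt_integral_comp_add hN s τ).sub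
    (hD.integral_hasStrictDerivAt 0 0).hasDerivAt
  refine sub_eq_zero.1 (IsLocalMin.hasDerivAt_eq_zero (.of_forall fun h => ?_) hderiv)
  have := hle h
  have hNh : Continuous fun t => N (t + h) := hN.comp (continuous_add_const h)
  rw [intervalIntegral.integral_sub (hNh.intervalIntegrable _ _)
    (hN.intervalIntegrable _ _)] at this
  simp only [Pi.sub_apply, add_zero, intervalIntegral.integral_same, sub_zero]
  linarith

theorem two_mul_inner_sub_le_norm_sq_sub_norm_sq {K : Type*} [NormedAddCommGroup K]
    [InnerProductSpace ℝ K] (a b : K) : 2 * ⟪a - b, b⟫ ≤ ‖a‖ ^ 2 - ‖b‖ ^ 2 := by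
  rw [inner_sub_left, real_inner_self_eq_norm_sq]
  nlinarith [norm_sub_sq_real a b, sq_nonneg ‖a - b‖]

theorem integral_apply_indicator_Ioc {E : Type*} [Zero E] {s τ : ℝ} (hsτ : s ≤ τ) (w : ℝ → E)
    (F : ℝ → E → ℝ) (hF : ∀ t, F t 0 = 0) :
    ∫ t, F t ((Ioc s τ).indicator w t) = ∫ t in s..τ, F t (w t) := by
  rw [intervalIntegral.integral_of_le hsτ, ← integral_indicator measurableSet_Ioc]
  congr 1 with t
  by_cases ht : t ∈ Ioc s τ <;> simp [ht, hF]

/-- Convexity of `‖·‖ ^ 2` gives `‖Y (t + h)‖ ^ 2 - ‖Y t‖ ^ 2 ≥ 2 ⟪Y (t + h) - Y t, J (w t)⟫` for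
both signs of `h`; integrate in `t` and let `h → 0`. -/
theorem norm_sq_sub_norm_sq_eq_integral {E K : Type*} [NormedAddCommGroup E] [NormedSpace ℝ E]
    [NormedAddCommGroup K] [InnerProductSpace ℝ K] {J : E → K} {g : ℝ → StrongDual ℝ E}
    {w : ℝ → E} {Y : ℝ → K} {s τ : ℝ} (hsτ : s ≤ τ) (hY : Continuous Y) (hg : MemLp g 2 volume)
    (hw : MemLp w 2 (volume.restrict (Ioc s τ)))
    (hYw : ∀ᵐ t ∂(volume.restrict (Ioc s τ)), Y t = J (w t))
    (hinc : ∀ v t t', ⟪Y t' - Y t, J v⟫ = ∫ r in t..t', g r v) :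
    ‖Y τ‖ ^ 2 - ‖Y s‖ ^ 2 = 2 * ∫ r in s..τ, g r (w r) := by
  set b := (Ioc s τ).indicator w
  have hbL : MemLp b 2 volume := (memLp_indicator_iff_restrict measurableSet_Ioc).2 hw
  have hle : ∀ h, ∫ σ in (0 : ℝ)..h, 2 * ∫ t, g (σ + t) (b t)
      ≤ ∫ t in s..τ, (‖Y (t + h)‖ ^ 2 - ‖Y t‖ ^ 2) := fun h => by
    have hfin : IsFiniteMeasure (volume.restrict (uIoc 0 h)) := ⟨by simp [uIoc]⟩
    have hYh : Continuous fun t => Y (t + h) := hY.comp (continuous_add_const h)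
    have hinner : Continuous fun t => 2 * ⟪Y (t + h) - Y t, Y t⟫ :=
      continuous_const.mul ((hYh.sub hY).inner hY)
    calc ∫ σ in (0 : ℝ)..h, 2 * ∫ t, g (σ + t) (b t)
        = 2 * ∫ t, ∫ σ in (0 : ℝ)..h, g (σ + t) (b t) := by
          rw [intervalIntegral.integral_const_mul, intervalIntegral_integral_swap
            (integrable_prod_translate_apply hg hbL (volume.restrict (uIoc 0 h)))]
      _ = ∫ t in s..τ, 2 * ⟪Y (t + h) - Y t, Y t⟫ := by
          rw [integral_apply_indicator_Ioc hsτ w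
            (fun t v => ∫ σ in (0 : ℝ)..h, g (σ + t) v) (by simp),
            ← intervalIntegral.integral_const_mul, intervalIntegral.integral_of_le hsτ,
            intervalIntegral.integral_of_le hsτ]
          refine integral_congr_ae (hYw.mono fun t ht => ?_)
          simp only
          rw [intervalIntegral.integral_comp_add_right (fun r => g r (w t)), zero_add,
            add_comm h, ← hinc, ← ht]
      _ ≤ ∫ t in s..τ, (‖Y (t + h)‖ ^ 2 - ‖Y t‖ ^ 2) :=
          intervalIntegral.integral_mono_on hsτ (hinner.intervalIntegrable _ _)
            (((hYh.norm.pow 2).sub (hY.norm.pow 2)).intervalIntegrable _ _)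
            fun t _ => two_mul_inner_sub_le_norm_sq_sub_norm_sq _ _
  have hcont : Continuous fun σ => 2 * ∫ t, g (σ + t) (b t) :=
    (continuous_integral_translate_apply hg hbL).const_mul 2
  have hN : Continuous fun t => ‖Y t‖ ^ 2 := hY.norm.pow 2
  rw [sub_eq_of_forall_integral_le hN hcont hle,
    integral_apply_indicator_Ioc hsτ w (fun t => g (0 + t)) (by simp)]
  simp only [zero_add]

theorem intervalIntegrable_of_mem_Icc {E : Type*} [NormedAddCommGroup E] {f : ℝ → E}
    {a b s t : ℝ} (hf : IntegrableOn f (Ioo a b)) (hs : s ∈ Icc a b) (ht : t ∈ Icc a b) :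
    IntervalIntegrable f volume s t :=
  ((intervalIntegrable_iff_integrableOn_Ioo_of_le (hs.1.trans hs.2)).2 hf).mono_set
    (uIcc_subset_uIcc (Icc_subset_uIcc hs) (Icc_subset_uIcc ht))

theorem intervalIntegral_indicator_Ioo {f : ℝ → ℝ} {a b : ℝ} (hab : a ≤ b)
    (hf : IntegrableOn f (Ioo a b)) (s t : ℝ) :
    ∫ r in s..t, (Ioo a b).indicator f r
      = ∫ r in (projIcc a b hab s : ℝ)..projIcc a b hab t, f r := by
  have hint : ∀ s t, IntervalIntegrable ((Ioo a b).indicator f) volume s t := fun s t =>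
    ((integrable_indicator_iff measurableSet_Ioo).2 hf).intervalIntegrable
  have hproj : ∀ t, ∫ r in a..t, (Ioo a b).indicator f r
      = ∫ r in a..projIcc a b hab t, (Ioo a b).indicator f r := fun t => by
    rw [← sub_eq_zero, intervalIntegral.integral_interval_sub_left (hint _ _) (hint _ _)]
    refine intervalIntegral.integral_zero_ae (.of_forall fun r hr => indicator_of_notMem ?_ f)
    rcases le_total t a with hta | hat
    · rw [projIcc_of_le_left hab hta, uIoc_of_ge hta] at hr
      exact fun h => hr.2.not_gt h.1
    rcases le_total t b with htb | hbt
    · simp [projIcc_of_mem hab ⟨hat, htb⟩] at hr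
    · rw [projIcc_of_right_le hab hbt, uIoc_of_le hbt] at hr
      exact fun h => hr.1.not_gt h.2
  rw [← intervalIntegral.integral_interval_sub_left (hint a t) (hint a s), hproj t, hproj s,
    intervalIntegral.integral_interval_sub_left (hint _ _) (hint _ _)]
  refine intervalIntegral.integral_congr_uIoo fun r hr => ?_
  have hmem : r ∈ Ioo a b :=
    ⟨(le_min (projIcc a b hab s).2.1 (projIcc a b hab t).2.1).trans_lt hr.1,
      hr.2.trans_le (max_le (projIcc a b hab s).2.2 (projIcc a b hab t).2.2)⟩
  exact indicator_of_mem hmem f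

theorem HasWeakDerivOn.sub_eq_integral {f g : ℝ → ℝ} {a b s t : ℝ}
    (h : HasWeakDerivOn (Ioo a b) f g) (hf : ContinuousOn f (Icc a b))
    (hg : IntegrableOn g (Ioo a b)) (hs : s ∈ Icc a b) (ht : t ∈ Icc a b) :
    f t - f s = ∫ r in s..t, g r := by
  rcases (hs.1.trans hs.2).eq_or_lt with rfl | hab
  · simp [Icc_self, mem_singleton_iff] at hs ht
    simp [hs, ht]
  have hmid : (a + b) / 2 ∈ Ioo a b := ⟨by linarith, by linarith⟩
  have hmid' := Ioo_subset_Icc_self hmid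
  obtain ⟨c, hc⟩ := h.exists_ae_eq_add_integral isOpen_Ioo ordConnected_Ioo hmid
    ((hf.mono Ioo_subset_Icc_self).locallyIntegrableOn measurableSet_Ioo) hg.locallyIntegrableOn
  have heq : EqOn f (fun x => c + ∫ r in ((a + b) / 2)..x, g r) (Icc a b) := by
    refine Measure.eqOn_Icc_of_ae_eq volume hab.ne ?_ hf (continuousOn_const.add ?_)
    · rwa [← restrict_Ioo_eq_restrict_Icc]
    · have hprim := intervalIntegral.continuousOn_primitive_interval'
        (intervalIntegrable_of_mem_Icc hg (left_mem_Icc.2 hab.le) (right_mem_Icc.2 hab.le))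
        (Icc_subset_uIcc hmid')
      rwa [uIcc_of_le hab.le] at hprim
  rw [heq hs, heq ht, add_sub_add_left_eq_sub, intervalIntegral.integral_interval_sub_left
    (intervalIntegrable_of_mem_Icc hg hmid' ht) (intervalIntegrable_of_mem_Icc hg hmid' hs)]

/- `memLp_indicator_iff_restrict` does not unify with dual-valued functions in reasonable time. -/
theorem memLp_indicator_of_restrict {α F : Type*} [MeasurableSpace α] {μ : Measure α}
    [NormedAddCommGroup F] {f : α → F} {p : ℝ≥0∞} {s : Set α} (hs : MeasurableSet s)
    (hf : MemLp f p (μ.restrict s)) : MemLp (s.indicator f) p μ :=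
  (memLp_indicator_iff_restrict hs).2 hf

theorem norm_sq_sub_norm_sq_eq_integral_of_continuousOn {E K : Type*} [NormedAddCommGroup E]
    [NormedSpace ℝ E] [NormedAddCommGroup K] [InnerProductSpace ℝ K] {J : E → K}
    {g : ℝ → StrongDual ℝ E} {w : ℝ → E} {Y : ℝ → K} {a b s t : ℝ} (hY : ContinuousOn Y (Icc a b))
    (hg : MemLp g 2 (volume.restrict (Ioo a b))) (hw : MemLp w 2 (volume.restrict (Ioo a b)))
    (hYw : ∀ᵐ r ∂(volume.restrict (Ioo a b)), Y r = J (w r))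
    (hinc : ∀ v, ∀ r ∈ Icc a b, ∀ r' ∈ Icc a b, ⟪Y r' - Y r, J v⟫ = ∫ q in r..r', g q v)
    (hs : s ∈ Icc a b) (ht : t ∈ Icc a b) (hst : s ≤ t) :
    ‖Y t‖ ^ 2 - ‖Y s‖ ^ 2 = 2 * ∫ r in s..t, g r (w r) := by
  have hab : a ≤ b := hs.1.trans hs.2
  have hle : volume.restrict (Ioc s t) ≤ volume.restrict (Ioo a b) := by
    rw [restrict_Ioo_eq_restrict_Ioc]
    exact Measure.restrict_mono (Ioc_subset_Ioc hs.1 ht.2) le_rfl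
  have hcont : Continuous fun r => Y (projIcc a b hab r) :=
    hY.comp_continuous (by fun_prop) fun r => (projIcc a b hab r).2
  have hproj : ∀ v r r', ⟪Y (projIcc a b hab r') - Y (projIcc a b hab r), J v⟫
      = ∫ q in r..r', (Ioo a b).indicator g q v := fun v r r' => by
    have hint : IntegrableOn (fun q => g q v) (Ioo a b) :=
      ((ContinuousLinearMap.apply ℝ ℝ v).comp_memLp' hg).integrable one_le_two
    rw [hinc v _ (projIcc a b hab r).2 _ (projIcc a b hab r').2,
      ← intervalIntegral_indicator_Ioo hab hint]
    refine intervalIntegral.integral_congr fun q _ => ?_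
    by_cases hq : q ∈ Ioo a b <;> simp [hq]
  have henergy := norm_sq_sub_norm_sq_eq_integral hst hcont
    (memLp_indicator_of_restrict measurableSet_Ioo hg) (hw.mono_measure hle) (by
      filter_upwards [ae_mono hle hYw, ae_restrict_mem measurableSet_Ioc] with r hr hmem
      rwa [projIcc_of_mem hab ⟨hs.1.trans hmem.1.le, hmem.2.trans ht.2⟩]) hproj
  simp only [projIcc_of_mem hab hs, projIcc_of_mem hab ht] at henergy
  rw [henergy, intervalIntegral.integral_congr_Ioo_of_le hst]
  intro r hr
  simp only [indicator_of_mem (show r ∈ Ioo a b from ⟨hs.1.trans_lt hr.1, hr.2.trans_le ht.2⟩)]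

/-- `Y` represents `y ∈ W(V)` in `C([0,T];H)`. Only the values of `Y` on `[0, T]` matter. -/
structure IsContRep {T : ℝ} (y : W T) (Y : ℝ → H) : Prop where
  continuousOn : ContinuousOn Y (Icc 0 T)
  ae_eq : ∀ᵐ t ∂(timeMeasure T), Y t = toL2 (val y t)

section TimeIntegrals

variable {T : ℝ} {y : W T} {Y : ℝ → H} {s t : ℝ}

theorem memLp_val (y : W T) : MemLp (val y) 2 (timeMeasure T) :=
  Lp.memLp _

theorem memLp_timeDeriv (y : W T) : MemLp (timeDeriv y) 2 (timeMeasure T) :=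
  Lp.memLp _

theorem integrable_timeDeriv_apply (y : W T) (v : V) :
    Integrable (fun t => timeDeriv y t v) (timeMeasure T) :=
  (memLp_apply (show WSubmodule T from y).1.snd v).integrable (by norm_num)

theorem hasWeakDerivOn_inner_val (y : W T) (v : V) :
    HasWeakDerivOn (Ioo 0 T) (fun t => ⟪toL2 (val y t), toL2 v⟫) (fun t => timeDeriv y t v) :=
  (show WSubmodule T from y).2 v

theorem IsContRep.inner_sub_eq_integral (hY : IsContRep y Y) (v : V) (hs : s ∈ Icc 0 T)
    (ht : t ∈ Icc 0 T) : ⟪Y t - Y s, toL2 v⟫ = ∫ r in s..t, timeDeriv y r v := by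
  have hderiv : HasWeakDerivOn (Ioo 0 T) (fun t => ⟪Y t, toL2 v⟫) (fun t => timeDeriv y t v) :=
    (hasWeakDerivOn_inner_val y v).congr (hY.ae_eq.mono fun r hr => by simp only [hr]) .rfl
  rw [inner_sub_left]
  exact hderiv.sub_eq_integral (hY.continuousOn.inner continuousOn_const)
    (integrable_timeDeriv_apply y v) hs ht

theorem IsContRep.norm_sq_sub_norm_sq (hY : IsContRep y Y) (hs : s ∈ Icc 0 T) (ht : t ∈ Icc 0 T)
    (hst : s ≤ t) : ‖Y t‖ ^ 2 - ‖Y s‖ ^ 2 = 2 * ∫ r in s..t, timeDeriv y r (val y r) :=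
  norm_sq_sub_norm_sq_eq_integral_of_continuousOn hY.continuousOn (memLp_timeDeriv y) (memLp_val y)
    hY.ae_eq (fun v _ hr _ hr' => hY.inner_sub_eq_integral v hr hr') hs ht hst

end TimeIntegrals

/-! ## Energy estimates -/

theorem integral_timeMeasure {T : ℝ} (hT : 0 ≤ T) (f : ℝ → ℝ) :
    ∫ t, f t ∂(timeMeasure T) = ∫ t in (0 : ℝ)..T, f t := by
  rw [intervalIntegral.integral_of_le hT, integral_Ioc_eq_integral_Ioo]

section IntegralEstimates

variable {a b s t : ℝ}

theorem intervalIntegral_mono_ae_Ioo {f g : ℝ → ℝ} (hf : IntegrableOn f (Ioo a b))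
    (hg : IntegrableOn g (Ioo a b)) (hfg : ∀ᵐ r ∂(volume.restrict (Ioo a b)), f r ≤ g r)
    (hs : s ∈ Icc a b) (ht : t ∈ Icc a b) (hst : s ≤ t) :
    ∫ r in s..t, f r ≤ ∫ r in s..t, g r := by
  refine intervalIntegral.integral_mono_ae_restrict hst (intervalIntegrable_of_mem_Icc hf hs ht)
    (intervalIntegrable_of_mem_Icc hg hs ht) ?_
  rw [restrict_Ioo_eq_restrict_Icc] at hfg
  exact ae_restrict_of_ae_restrict_of_subset (Icc_subset_Icc hs.1 ht.2) hfg

theorem intervalIntegral_le_of_nonneg {f : ℝ → ℝ} (hf : IntegrableOn f (Ioo a b))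
    (hf0 : ∀ r, 0 ≤ f r) (hs : s ∈ Icc a b) (ht : t ∈ Icc a b) (hst : s ≤ t) :
    ∫ r in s..t, f r ≤ ∫ r in a..b, f r :=
  intervalIntegral.integral_mono_interval hs.1 hst ht.2 (.of_forall hf0)
    ((intervalIntegrable_iff_integrableOn_Ioo_of_le (hs.1.trans hs.2)).2 hf)

theorem integrableOn_mul_continuousOn {f g : ℝ → ℝ} (hf : IntegrableOn f (Ioo a b))
    (hg : ContinuousOn g (Icc a b)) : IntegrableOn (fun r => f r * g r) (Ioo a b) :=
  have hf' : IntegrableOn f (Icc a b) := by rwa [integrableOn_Icc_iff_integrableOn_Ioo]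
  (hf'.mul_continuousOn hg isCompact_Icc).mono_set Ioo_subset_Icc_self

theorem mul_le_sq_div_add_mul_sq {c : ℝ} (hc : 0 < c) (x y : ℝ) :
    x * y ≤ y ^ 2 / (4 * c) + c * x ^ 2 := by
  have hsq : 0 ≤ (y - 2 * c * x) ^ 2 / (4 * c) := by positivity
  have hexpand : (y - 2 * c * x) ^ 2 / (4 * c) = y ^ 2 / (4 * c) + c * x ^ 2 - x * y := by field
  linarith

/-- Bound `n` under the integral by its maximum `m`, absorb `m` by Young's inequality, and evaluate
at the point where the maximum is attained. -/
theorem sq_add_le_of_le_add_integral_abs_mul {n D f : ℝ → ℝ} {A : ℝ} (hab : a < b)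
    (hn : ContinuousOn n (Icc a b)) (hD : ∀ t ∈ Icc a b, 0 ≤ D t)
    (hf : MemLp f 2 (volume.restrict (Ioo a b)))
    (h : ∀ t ∈ Icc a b, n t ^ 2 + D t ≤ A + 2 * ∫ r in a..t, |f r| * n r) (ht : t ∈ Icc a b) :
    n t ^ 2 + D t ≤ 2 * A + 4 * (b - a) * ∫ r in a..b, f r ^ 2 := by
  have ha := left_mem_Icc.2 hab.le
  have hb := right_mem_Icc.2 hab.le
  have hba : 0 < b - a := sub_pos.2 hab
  obtain ⟨t₀, ht₀, hmax⟩ := isCompact_Icc.exists_isMaxOn ⟨a, ha⟩ hn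
  have hf2 : IntegrableOn (fun r => f r ^ 2) (Ioo a b) := hf.integrable_sq
  have hyoung : IntegrableOn (fun r => n t₀ ^ 2 / (4 * (b - a)) + (b - a) * f r ^ 2) (Ioo a b) :=
    (integrable_const _).add (hf2.const_mul _)
  have hpt : ∀ᵐ r ∂(volume.restrict (Ioo a b)),
      |f r| * n r ≤ n t₀ ^ 2 / (4 * (b - a)) + (b - a) * f r ^ 2 := by
    filter_upwards [ae_restrict_mem measurableSet_Ioo] with r hr
    refine (mul_le_mul_of_nonneg_left (hmax (Ioo_subset_Icc_self hr)) (abs_nonneg _)).trans ?_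
    rw [← sq_abs (f r)]
    exact mul_le_sq_div_add_mul_sq hba _ _
  have hint : ∀ r ∈ Icc a b,
      ∫ q in a..r, |f q| * n q ≤ n t₀ ^ 2 / 4 + (b - a) * ∫ q in a..b, f q ^ 2 := fun r hr =>
    calc ∫ q in a..r, |f q| * n q
        ≤ ∫ q in a..r, (n t₀ ^ 2 / (4 * (b - a)) + (b - a) * f q ^ 2) :=
          intervalIntegral_mono_ae_Ioo
            (integrableOn_mul_continuousOn (hf.integrable one_le_two).abs hn) hyoung hpt ha hr hr.1
      _ ≤ ∫ q in a..b, (n t₀ ^ 2 / (4 * (b - a)) + (b - a) * f q ^ 2) :=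
          intervalIntegral_le_of_nonneg hyoung (fun q => by positivity) ha hr hr.1
      _ = n t₀ ^ 2 / 4 + (b - a) * ∫ q in a..b, f q ^ 2 := by
          rw [intervalIntegral.integral_add (by simp)
            (intervalIntegrable_of_mem_Icc (hf2.const_mul _) ha hb)]
          simp only [intervalIntegral.integral_const, intervalIntegral.integral_const_mul,
            smul_eq_mul]
          field
  have hm : n t₀ ^ 2 ≤ 2 * A + 4 * ((b - a) * ∫ q in a..b, f q ^ 2) := by
    linarith [h t₀ ht₀, hint t₀ ht₀, hD t₀ ht₀]
  linarith [h t ht, hint t ht]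

end IntegralEstimates

section EnergyEstimates

variable {ν T κ R : ℝ} {χ : ℝ → ℝ} {u : L2 (Ioo 0 T)} {y p : W T} {Y P : ℝ → H} {t : ℝ}

theorem integrable_norm_sq_val (y : W T) : Integrable (fun t => ‖val y t‖ ^ 2) (timeMeasure T) :=
  (memLp_val y).integrable_norm_pow two_ne_zero

theorem integrable_norm_sq_timeDeriv (y : W T) :
    Integrable (fun t => ‖timeDeriv y t‖ ^ 2) (timeMeasure T) :=
  (memLp_timeDeriv y).integrable_norm_pow two_ne_zero

theorem integrable_norm_sq_weakDeriv_val (y : W T) :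
    Integrable (fun t => ‖weakDeriv (val y t)‖ ^ 2) (timeMeasure T) :=
  ((weakDeriv (Ω := univ)).comp_memLp' (memLp_val y)).integrable_norm_pow two_ne_zero

theorem integrable_timeDeriv_val (y : W T) :
    Integrable (fun t => timeDeriv y t (val y t)) (timeMeasure T) :=
  integrable_apply_of_memLp_two (memLp_timeDeriv y) (memLp_val y)

theorem W.norm_sq_eq (hT : 0 ≤ T) (y : W T) :
    ‖y‖ ^ 2 = (∫ t in (0 : ℝ)..T, ‖val y t‖ ^ 2) + ∫ t in (0 : ℝ)..T, ‖timeDeriv y t‖ ^ 2 := by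
  rw [← integral_timeMeasure hT, ← integral_timeMeasure hT]
  refine (WithLp.prod_norm_sq_eq_of_L2 (show WSubmodule T from y).1).trans ?_
  rw [Lp_norm_sq_eq_integral, Lp_norm_sq_eq_integral]
  rfl

theorem integral_norm_sq_weakDeriv_val_nonneg (y : W T) {s t : ℝ} (hst : s ≤ t) :
    0 ≤ ∫ r in s..t, ‖weakDeriv (val y r)‖ ^ 2 :=
  intervalIntegral.integral_nonneg hst fun _ _ => by positivity

theorem IsContRep.integral_norm_sq_val_le (hT : 0 ≤ T) (hY : IsContRep y Y)
    (hR : ∀ t ∈ Icc 0 T, ‖Y t‖ ^ 2 ≤ R) :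
    ∫ t in (0 : ℝ)..T, ‖val y t‖ ^ 2
      ≤ T * R + ∫ t in (0 : ℝ)..T, ‖weakDeriv (val y t)‖ ^ 2 := by
  have h0 := left_mem_Icc.2 hT
  have hTT := right_mem_Icc.2 hT
  have hw := integrable_norm_sq_weakDeriv_val y
  calc ∫ t in (0 : ℝ)..T, ‖val y t‖ ^ 2
      ≤ ∫ t in (0 : ℝ)..T, (R + ‖weakDeriv (val y t)‖ ^ 2) := by
        refine intervalIntegral_mono_ae_Ioo (integrable_norm_sq_val y)
          ((integrable_const R).add hw) ?_ h0 hTT hT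
        filter_upwards [hY.ae_eq, ae_restrict_mem measurableSet_Ioo] with t ht hmem
        rw [H1.norm_sq_eq (val y t), ← ht]
        gcongr
        exact hR t (Ioo_subset_Icc_self hmem)
    _ = T * R + ∫ t in (0 : ℝ)..T, ‖weakDeriv (val y t)‖ ^ 2 := by
        rw [intervalIntegral.integral_add (by simp) (intervalIntegrable_of_mem_Icc hw h0 hTT)]
        simp

/-- `y` satisfies the weak viscous Burgers equation
`∂ₜy + y ∂ₓy - ν ∂ₓ²y = χ u` for almost every time. -/
def SolvesBurgers (ν : ℝ) (χ : ℝ → ℝ) (u : L2 (Ioo 0 T)) (y : W T) : Prop :=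
  ∀ᵐ t ∂(timeMeasure T), ∀ φ : V,
    timeDeriv y t φ + (∫ x, toL2 (val y t) x * weakDeriv (val y t) x * toL2 φ x)
      + ν * ⟪weakDeriv (val y t), weakDeriv φ⟫ = u t * ∫ x, χ x * toL2 φ x

/-- `p` satisfies the weak adjoint equation `∂ₜp + y ∂ₓp + ν ∂ₓ²p = 0`, linearised at the state `y`,
for almost every time. -/
def SolvesAdjoint (ν : ℝ) (y p : W T) : Prop :=
  ∀ᵐ t ∂(timeMeasure T), ∀ φ : V,
    timeDeriv p t φ + (∫ x, toL2 (val y t) x * weakDeriv (val p t) x * toL2 φ x)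
      - ν * ⟪weakDeriv (val p t), weakDeriv φ⟫ = 0

theorem SolvesBurgers.ae_timeDeriv_val_le (h : SolvesBurgers ν χ u y)
    (hχ : ∀ f : H, |∫ x, χ x * f x| ≤ κ * ‖f‖) :
    ∀ᵐ t ∂(timeMeasure T), timeDeriv y t (val y t)
      ≤ |κ * u t| * ‖toL2 (val y t)‖ - ν * ‖weakDeriv (val y t)‖ ^ 2 := by
  filter_upwards [h] with t ht
  have heq := ht (val y t)
  rw [integral_toL2_mul_weakDeriv_mul_toL2, real_inner_self_eq_norm_sq] at heq
  have hforce : u t * ∫ x, χ x * toL2 (val y t) x ≤ |κ * u t| * ‖toL2 (val y t)‖ :=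
    calc u t * ∫ x, χ x * toL2 (val y t) x
        ≤ |u t| * |∫ x, χ x * toL2 (val y t) x| := by
          rw [← abs_mul]
          exact le_abs_self _
      _ ≤ |u t| * (|κ| * ‖toL2 (val y t)‖) := by
          gcongr
          exact (hχ _).trans (by gcongr; exact le_abs_self κ)
      _ = |κ * u t| * ‖toL2 (val y t)‖ := by rw [abs_mul]; ring
  linarith

theorem SolvesBurgers.norm_sq_add_le (hν : 0 ≤ ν) (hT : 0 < T) (h : SolvesBurgers ν χ u y)
    (hχ : ∀ f : H, |∫ x, χ x * f x| ≤ κ * ‖f‖) (hY : IsContRep y Y) (ht : t ∈ Icc 0 T) :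
    ‖Y t‖ ^ 2 + 2 * ν * ∫ r in (0 : ℝ)..t, ‖weakDeriv (val y r)‖ ^ 2
      ≤ 2 * ‖Y 0‖ ^ 2 + 4 * T * κ ^ 2 * ‖u‖ ^ 2 := by
  have h0 := left_mem_Icc.2 hT.le
  have hw := integrable_norm_sq_weakDeriv_val y
  have hf : MemLp (fun r => κ * u r) 2 (timeMeasure T) := (Lp.memLp u).const_mul κ
  have hfY : IntegrableOn (fun r => |κ * u r| * ‖Y r‖) (Ioo 0 T) :=
    integrableOn_mul_continuousOn (hf.integrable one_le_two).abs hY.continuousOn.norm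
  have henergy : ∀ r ∈ Icc 0 T,
      ‖Y r‖ ^ 2 + 2 * ν * ∫ q in (0 : ℝ)..r, ‖weakDeriv (val y q)‖ ^ 2
        ≤ ‖Y 0‖ ^ 2 + 2 * ∫ q in (0 : ℝ)..r, |κ * u q| * ‖Y q‖ := fun r hr => by
    have hle := intervalIntegral_mono_ae_Ioo (integrable_timeDeriv_val y)
      (hfY.sub (hw.const_mul ν)) (by
        filter_upwards [h.ae_timeDeriv_val_le hχ, hY.ae_eq] with q hq hYq
        simpa only [Pi.sub_apply, hYq] using hq) h0 hr hr.1
    simp only [Pi.sub_apply] at hle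
    rw [intervalIntegral.integral_sub (intervalIntegrable_of_mem_Icc hfY h0 hr)
      (intervalIntegrable_of_mem_Icc (hw.const_mul ν) h0 hr),
      intervalIntegral.integral_const_mul] at hle
    linarith [hY.norm_sq_sub_norm_sq h0 hr hr.1]
  have hdiss : ∀ r ∈ Icc 0 T, 0 ≤ 2 * ν * ∫ q in (0 : ℝ)..r, ‖weakDeriv (val y q)‖ ^ 2 :=
    fun r hr => mul_nonneg (by positivity) (integral_norm_sq_weakDeriv_val_nonneg y hr.1)
  have hforce : ∫ q in (0 : ℝ)..T, (κ * u q) ^ 2 = κ ^ 2 * ‖u‖ ^ 2 := by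
    simp only [mul_pow, intervalIntegral.integral_const_mul, Lp_norm_sq_eq_integral,
      Real.norm_eq_abs, sq_abs, integral_timeMeasure hT.le]
  have hmain := sq_add_le_of_le_add_integral_abs_mul hT hY.continuousOn.norm hdiss hf henergy ht
  rw [hforce, sub_zero] at hmain
  linarith

theorem SolvesAdjoint.ae_le_two_mul_timeDeriv_val (hν : 0 < ν) (h : SolvesAdjoint ν y p) :
    ∀ᵐ t ∂(timeMeasure T),
      ν * ‖weakDeriv (val p t)‖ ^ 2 - ‖val y t‖ ^ 2 / ν * ‖toL2 (val p t)‖ ^ 2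
        ≤ 2 * timeDeriv p t (val p t) := by
  filter_upwards [h] with t ht
  have heq := ht (val p t)
  rw [real_inner_self_eq_norm_sq] at heq
  have hconv := (abs_le.1
    (abs_integral_toL2_mul_mul_le (val y t) (weakDeriv (val p t)) (toL2 (val p t)))).2
  have hyoung := mul_le_sq_div_add_mul_sq hν ‖weakDeriv (val p t)‖
    (2 * (‖val y t‖ * ‖toL2 (val p t)‖))
  have hsq : (2 * (‖val y t‖ * ‖toL2 (val p t)‖)) ^ 2 / (4 * ν)
      = ‖val y t‖ ^ 2 / ν * ‖toL2 (val p t)‖ ^ 2 := by field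
  linarith

theorem SolvesAdjoint.norm_sq_add_le (hν : 0 < ν) (h : SolvesAdjoint ν y p) (hP : IsContRep p P)
    (ht : t ∈ Icc 0 T) :
    ‖P t‖ ^ 2 + ν * ∫ r in t..T, ‖weakDeriv (val p r)‖ ^ 2
      ≤ ‖P T‖ ^ 2 * Real.exp (∫ r in t..T, ‖val y r‖ ^ 2 / ν) := by
  have hTT : T ∈ Icc 0 T := right_mem_Icc.2 (ht.1.trans ht.2)
  have hw := integrable_norm_sq_weakDeriv_val p
  have hβ : IntegrableOn (fun r => ‖val y r‖ ^ 2 / ν) (Ioo 0 T) :=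
    (integrable_norm_sq_val y).div_const ν
  have hN : ContinuousOn (fun r => ‖P r‖ ^ 2) (Icc 0 T) := hP.continuousOn.norm.pow 2
  have hβN := integrableOn_mul_continuousOn hβ hN
  have henergy : ∀ r ∈ Icc 0 T, ‖P r‖ ^ 2 + ν * ∫ q in r..T, ‖weakDeriv (val p q)‖ ^ 2
      ≤ ‖P T‖ ^ 2 + ∫ q in r..T, ‖val y q‖ ^ 2 / ν * ‖P q‖ ^ 2 := fun r hr => by
    have hle := intervalIntegral_mono_ae_Ioo ((hw.const_mul ν).sub hβN)
      ((integrable_timeDeriv_val p).const_mul 2) (by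
        filter_upwards [h.ae_le_two_mul_timeDeriv_val hν, hP.ae_eq] with q hq hPq
        simpa only [Pi.sub_apply, hPq] using hq) hr hTT hr.2
    simp only [Pi.sub_apply] at hle
    rw [intervalIntegral.integral_sub (intervalIntegrable_of_mem_Icc (hw.const_mul ν) hr hTT)
      (intervalIntegrable_of_mem_Icc hβN hr hTT), intervalIntegral.integral_const_mul,
      intervalIntegral.integral_const_mul] at hle
    linarith [hP.norm_sq_sub_norm_sq hr hTT hr.2]
  have hdiss : ∀ r ∈ Icc 0 T, 0 ≤ ν * ∫ q in r..T, ‖weakDeriv (val p q)‖ ^ 2 := fun r hr =>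
    mul_nonneg hν.le (integral_norm_sq_weakDeriv_val_nonneg p hr.2)
  exact (henergy t ht).trans (gronwall_backward hN
    (intervalIntegrable_of_mem_Icc hβ (left_mem_Icc.2 hTT.1) hTT) (fun r => by positivity)
    (fun r hr => by linarith [henergy r hr, hdiss r hr]) ht)

theorem SolvesAdjoint.ae_norm_timeDeriv_le (hν : 0 ≤ ν) (h : SolvesAdjoint ν y p) :
    ∀ᵐ t ∂(timeMeasure T),
      ‖timeDeriv p t‖ ≤ (ν + ‖toL2 (val y t)‖) * ‖weakDeriv (val p t)‖ := by
  filter_upwards [h] with t ht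
  refine ContinuousLinearMap.opNorm_le_bound _ (by positivity) fun φ => ?_
  have heq : timeDeriv p t φ = ν * ⟪weakDeriv (val p t), weakDeriv φ⟫
      - ∫ x, toL2 φ x * toL2 (val y t) x * weakDeriv (val p t) x := by
    rw [← sub_eq_zero, ← ht φ]
    simp only [mul_comm (toL2 φ _), mul_right_comm _ (toL2 φ _)]
    ring
  have hvisc : |⟪weakDeriv (val p t), weakDeriv φ⟫| ≤ ‖weakDeriv (val p t)‖ * ‖φ‖ :=
    (abs_real_inner_le_norm _ _).trans (by gcongr; exact norm_weakDeriv_le φ)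
  have hconv := abs_integral_toL2_mul_mul_le φ (toL2 (val y t)) (weakDeriv (val p t))
  calc ‖timeDeriv p t φ‖
      ≤ ν * |⟪weakDeriv (val p t), weakDeriv φ⟫|
        + |∫ x, toL2 φ x * toL2 (val y t) x * weakDeriv (val p t) x| := by
        rw [heq, Real.norm_eq_abs]
        exact (abs_sub _ _).trans_eq (by rw [abs_mul, abs_of_nonneg hν])
    _ ≤ ν * (‖weakDeriv (val p t)‖ * ‖φ‖)
        + ‖φ‖ * ‖toL2 (val y t)‖ * ‖weakDeriv (val p t)‖ := by gcongr
    _ = (ν + ‖toL2 (val y t)‖) * ‖weakDeriv (val p t)‖ * ‖φ‖ := by ring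

theorem SolvesAdjoint.integral_norm_sq_timeDeriv_le (hν : 0 ≤ ν) (hT : 0 ≤ T)
    (h : SolvesAdjoint ν y p) (hY : IsContRep y Y) (hR : ∀ t ∈ Icc 0 T, ‖Y t‖ ^ 2 ≤ R) :
    ∫ t in (0 : ℝ)..T, ‖timeDeriv p t‖ ^ 2
      ≤ 2 * (ν ^ 2 + R) * ∫ t in (0 : ℝ)..T, ‖weakDeriv (val p t)‖ ^ 2 := by
  rw [← intervalIntegral.integral_const_mul]
  refine intervalIntegral_mono_ae_Ioo (integrable_norm_sq_timeDeriv p)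
    ((integrable_norm_sq_weakDeriv_val p).const_mul _) ?_ (left_mem_Icc.2 hT) (right_mem_Icc.2 hT)
    hT
  filter_upwards [h.ae_norm_timeDeriv_le hν, hY.ae_eq, ae_restrict_mem measurableSet_Ioo]
    with t ht hYt hmem
  rw [← hYt] at ht
  calc ‖timeDeriv p t‖ ^ 2
      ≤ (ν + ‖Y t‖) ^ 2 * ‖weakDeriv (val p t)‖ ^ 2 := by
        rw [← mul_pow]
        gcongr
    _ ≤ 2 * (ν ^ 2 + ‖Y t‖ ^ 2) * ‖weakDeriv (val p t)‖ ^ 2 := by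
        gcongr
        exact add_sq_le
    _ ≤ 2 * (ν ^ 2 + R) * ‖weakDeriv (val p t)‖ ^ 2 := by
        gcongr
        exact hR t (Ioo_subset_Icc_self hmem)

end EnergyEstimates

section AdjointBound

variable {ν T κ B R : ℝ} {χ : ℝ → ℝ} {u : L2 (Ioo 0 T)} {y p : W T} {Y P : ℝ → H}

theorem IsContRep.integral_norm_sq_val_div_le (hν : 0 < ν) (hT : 0 ≤ T) (hY : IsContRep y Y)
    (hR : ∀ t ∈ Icc 0 T, ‖Y t‖ ^ 2 + 2 * ν * ∫ r in (0 : ℝ)..t, ‖weakDeriv (val y r)‖ ^ 2 ≤ R) :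
    ∫ t in (0 : ℝ)..T, ‖val y t‖ ^ 2 / ν ≤ (T + 1 / (2 * ν)) / ν * R := by
  have hYR : ∀ t ∈ Icc 0 T, ‖Y t‖ ^ 2 ≤ R := fun t ht => by
    nlinarith [hR t ht, integral_norm_sq_weakDeriv_val_nonneg y ht.1]
  have hdiss : ∫ t in (0 : ℝ)..T, ‖weakDeriv (val y t)‖ ^ 2 ≤ R / (2 * ν) := by
    rw [le_div_iff₀' (by positivity)]
    linarith [hR T (right_mem_Icc.2 hT), sq_nonneg ‖Y T‖]
  calc ∫ t in (0 : ℝ)..T, ‖val y t‖ ^ 2 / ν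
      = (∫ t in (0 : ℝ)..T, ‖val y t‖ ^ 2) / ν := intervalIntegral.integral_div _ _
    _ ≤ (T * R + R / (2 * ν)) / ν := by
        gcongr
        exact (hY.integral_norm_sq_val_le hT hYR).trans (by gcongr)
    _ = (T + 1 / (2 * ν)) / ν * R := by ring

theorem SolvesAdjoint.norm_sq_le (hν : 0 < ν) (hT : 0 ≤ T) (h : SolvesAdjoint ν y p)
    (hP : IsContRep p P) (hY : IsContRep y Y) (hR : ∀ t ∈ Icc 0 T, ‖Y t‖ ^ 2 ≤ R)
    (hB : ∫ t in (0 : ℝ)..T, ‖val y t‖ ^ 2 / ν ≤ B) :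
    ‖p‖ ^ 2 ≤ (T + 3 / ν + 2 * ν) * Real.exp (R + B) * ‖P T‖ ^ 2 := by
  have h0 := left_mem_Icc.2 hT
  have hTT := right_mem_Icc.2 hT
  have hR0 : 0 ≤ R := (sq_nonneg _).trans (hR T hTT)
  obtain ⟨E, hE⟩ : ∃ E, E = ‖P T‖ ^ 2 * Real.exp B := ⟨_, rfl⟩
  have hE0 : 0 ≤ E := hE ▸ by positivity
  have henergy : ∀ t ∈ Icc 0 T,
      ‖P t‖ ^ 2 + ν * ∫ r in t..T, ‖weakDeriv (val p r)‖ ^ 2 ≤ E := fun t ht => by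
    refine hE ▸ (h.norm_sq_add_le hν hP ht).trans ?_
    gcongr
    exact (intervalIntegral_le_of_nonneg ((integrable_norm_sq_val y).div_const ν)
      (fun r => by positivity) ht hTT ht.2).trans hB
  have hPE : ∀ t ∈ Icc 0 T, ‖P t‖ ^ 2 ≤ E := fun t ht => by
    nlinarith [henergy t ht, integral_norm_sq_weakDeriv_val_nonneg p ht.2]
  have hdiss : ∫ r in (0 : ℝ)..T, ‖weakDeriv (val p r)‖ ^ 2 ≤ E / ν := by
    rw [le_div_iff₀' hν]
    linarith [henergy 0 h0, sq_nonneg ‖P 0‖]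
  have hexpR : R + 1 ≤ Real.exp R := Real.add_one_le_exp R
  calc ‖p‖ ^ 2
      = (∫ t in (0 : ℝ)..T, ‖val p t‖ ^ 2) + ∫ t in (0 : ℝ)..T, ‖timeDeriv p t‖ ^ 2 :=
        W.norm_sq_eq hT p
    _ ≤ (T * E + E / ν) + 2 * (ν ^ 2 + R) * (E / ν) := by
        gcongr
        · exact (hP.integral_norm_sq_val_le hT hPE).trans (by gcongr)
        · exact (h.integral_norm_sq_timeDeriv_le hν.le hT hY hR).trans (by gcongr)
    _ = (T + 1 / ν + 2 * ν) * 1 * E + 2 / ν * R * E := by field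
    _ ≤ (T + 1 / ν + 2 * ν) * Real.exp R * E + 2 / ν * Real.exp R * E := by
        gcongr <;> linarith
    _ = (T + 3 / ν + 2 * ν) * Real.exp (R + B) * ‖P T‖ ^ 2 := by
        rw [hE, Real.exp_add]
        ring

theorem SolvesAdjoint.norm_sq_le_of_solvesBurgers (hν : 0 < ν) (hT : 0 < T)
    (hχ : ∀ f : H, |∫ x, χ x * f x| ≤ κ * ‖f‖) (h : SolvesAdjoint ν y p) (hP : IsContRep p P)
    (hy : SolvesBurgers ν χ u y) (hY : IsContRep y Y) :
    ‖p‖ ^ 2 ≤ (T + 3 / ν + 2 * ν) * Real.exp ((1 + (T + 1 / (2 * ν)) / ν) * (2 + 4 * T * κ ^ 2)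
      * (‖u‖ ^ 2 + ‖Y 0‖ ^ 2)) * ‖P T‖ ^ 2 := by
  have hstate : ∀ t ∈ Icc 0 T,
      ‖Y t‖ ^ 2 + 2 * ν * ∫ r in (0 : ℝ)..t, ‖weakDeriv (val y r)‖ ^ 2
        ≤ (2 + 4 * T * κ ^ 2) * (‖u‖ ^ 2 + ‖Y 0‖ ^ 2) := fun t ht => by
    refine (hy.norm_sq_add_le hν.le hT hχ hY ht).trans ?_
    have : 0 ≤ 2 * ‖u‖ ^ 2 + 4 * T * κ ^ 2 * ‖Y 0‖ ^ 2 := by positivity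
    linarith
  have hYR : ∀ t ∈ Icc 0 T, ‖Y t‖ ^ 2 ≤ (2 + 4 * T * κ ^ 2) * (‖u‖ ^ 2 + ‖Y 0‖ ^ 2) :=
    fun t ht => by nlinarith [hstate t ht, integral_norm_sq_weakDeriv_val_nonneg y ht.1]
  refine (h.norm_sq_le hν hT.le hP hY hYR
    (hY.integral_norm_sq_val_div_le hν hT.le hstate)).trans_eq ?_
  congr 3
  ring

end AdjointBound

section StateConst

variable {T C δ : ℝ} {u : H1 (Ioo 0 T)} {y₀ : V}

theorem stateConst_nonneg (hC : 0 ≤ C) : 0 ≤ stateConst C u y₀ := by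
  rw [stateConst]
  positivity

theorem mul_exp_le_stateConst_sq (hC : 0 ≤ C) (hδ : 0 ≤ δ) (hu : δ ≤ ‖toL2 u‖ + ‖y₀‖) :
    C ^ 2 * δ ^ 4 * Real.exp (C * (‖toL2 u‖ ^ 2 + ‖toL2 y₀‖ ^ 2)) ≤ stateConst C u y₀ ^ 2 := by
  rw [stateConst, mul_pow, mul_pow, ← pow_mul]
  gcongr
  exact le_self_pow₀ (Real.one_le_exp (by positivity)) two_ne_zero

end StateConst

theorem ValueAt.exists_isContRep {T t : ℝ} {y : W T} {a : H} (h : ValueAt y t a) :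
    ∃ Y, IsContRep y Y ∧ Y t = a := by
  obtain ⟨Y, hcont, hae, hval⟩ := h
  exact ⟨Y, ⟨hcont, hae⟩, hval⟩

theorem IsDiscreteState.valueAt_zero {N : ℕ} {ν T ε : ℝ} {χ ζ : ℝ → ℝ} {X : Fin N → ℝ} {y₀ : V}
    {u : H1 (Ioo 0 T)} {y : W T} {Φ : Fin N → H1 (Ioo 0 T)}
    (h : IsDiscreteState ν χ ζ ε X y₀ u y Φ) : ValueAt y 0 (toL2 y₀) := by
  obtain ⟨a, ha, hψ⟩ := h.init
  rwa [← ext_inner_right ℝ hψ]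

theorem IsDiscreteAdjoint.valueAt_terminal {ν T : ℝ} {yd yT : H} {y p : W T}
    (h : IsDiscreteAdjoint ν yd yT y p) : ValueAt p T (yd - yT) := by
  obtain ⟨a, ha, hψ⟩ := h.terminal
  rwa [← ext_inner_right ℝ hψ]

end BurgersControl

open BurgersControl in
theorem mainTheorem11_general {ν T : ℝ} (hν : 0 < ν) (hT : 0 < T) {χ : ℝ → ℝ}
    (hχ : MemLp χ 2 volume) :
    ∃ C₀ : ℝ, 0 < C₀ ∧ ∀ C : ℝ, C₀ ≤ C → ∀ δ : ℝ, 0 < δ → ∃ c : ℝ, 0 < c ∧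
      ∀ (y₀ : V) (u : H1 (Ioo 0 T)), δ ≤ ‖toL2 u‖ + ‖y₀‖ →
      ∀ y : W T, SolvesBurgers ν χ (toL2 u) y → ValueAt y 0 (toL2 y₀) →
      ∀ (p : W T) (pT : H), SolvesAdjoint ν y p → ValueAt p T pT →
        ‖p‖ ≤ c * (stateConst C u y₀ ^ 4 + stateConst C u y₀ ^ 2) * ‖pT‖ := by
  have hχ' : MemLp χ 2 (volume.restrict univ) := by simpa only [Measure.restrict_univ]
  have hpair : ∀ f : H, |∫ x, χ x * f x| ≤ ‖hχ'.toLp‖ * ‖f‖ := fun f => by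
    simpa only [setIntegral_univ] using abs_integral_mul_le hχ' f
  set K := T + 3 / ν + 2 * ν
  set C₀ := (1 + (T + 1 / (2 * ν)) / ν) * (2 + 4 * T * ‖hχ'.toLp‖ ^ 2)
  have hC₀ : 0 < C₀ := by positivity
  refine ⟨C₀, hC₀, fun C hC δ hδ => ?_⟩
  have hCpos : 0 < C := hC₀.trans_le hC
  refine ⟨√K / (C ^ 2 * δ ^ 4), by positivity, fun y₀ u hu y hy hy0 p pT hp hpT => ?_⟩
  obtain ⟨Y, hY, hY0⟩ := hy0.exists_isContRep
  obtain ⟨P, hP, rfl⟩ := hpT.exists_isContRep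
  set M := ‖toL2 u‖ ^ 2 + ‖toL2 y₀‖ ^ 2
  have hexp : ‖p‖ ≤ √K * Real.exp (C * M) * ‖P T‖ := by
    refine le_of_sq_le_sq ?_ (by positivity)
    calc ‖p‖ ^ 2 ≤ K * Real.exp (C₀ * M) * ‖P T‖ ^ 2 := by
          simpa only [hY0] using hp.norm_sq_le_of_solvesBurgers hν hT hpair hP hy hY
      _ ≤ K * Real.exp (C * M) ^ 2 * ‖P T‖ ^ 2 := by
          gcongr
          calc Real.exp (C₀ * M) ≤ Real.exp (C * M) := by gcongr
            _ ≤ Real.exp (C * M) ^ 2 :=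
              le_self_pow₀ (Real.one_le_exp (by positivity)) two_ne_zero
      _ = (√K * Real.exp (C * M) * ‖P T‖) ^ 2 := by
          rw [mul_pow, mul_pow, Real.sq_sqrt (by positivity)]
  calc ‖p‖ ≤ √K * Real.exp (C * M) * ‖P T‖ := hexp
    _ = √K / (C ^ 2 * δ ^ 4) * (C ^ 2 * δ ^ 4 * Real.exp (C * M)) * ‖P T‖ := by field
    _ ≤ √K / (C ^ 2 * δ ^ 4) * (stateConst C u y₀ ^ 4 + stateConst C u y₀ ^ 2) * ‖P T‖ := by
        gcongr
        linarith [mul_exp_le_stateConst_sq hCpos.le hδ.le hu,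
          pow_nonneg (stateConst_nonneg (u := u) (y₀ := y₀) hCpos.le) 4]

theorem mainTheorem11 (ν T : ℝ) (hν : 0 < ν) (hT : 0 < T)
    (χ : ℝ → ℝ) (hχ : ContDiff ℝ ∞ χ) (hχc : HasCompactSupport χ) :
    ∃ C₀ : ℝ, 0 < C₀ ∧ ∀ C : ℝ, C₀ ≤ C → ∀ δ : ℝ, 0 < δ → ∃ c : ℝ, 0 < c ∧
      ∀ (y₀ : BurgersControl.V) (yd : BurgersControl.H),
        BurgersControl.HasBoundedSupport (BurgersControl.toL2 y₀) → BurgersControl.HasBoundedSupport yd →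
      ∀ (ul uu : ℝ), ∀ u ∈ BurgersControl.admissible T ul uu,
        δ ≤ ‖BurgersControl.toL2 u‖ + ‖y₀‖ →
      ∀ (r : ℕ) (ζ : ℝ → ℝ), BurgersControl.IsKernel r ζ →
      ∀ (ε : ℝ), 0 < ε → ∀ (N : ℕ) (X : Fin N → ℝ)
        (y : BurgersControl.W T) (Φ : Fin N → BurgersControl.H1 (Ioo 0 T)),
        BurgersControl.IsDiscreteState ν χ ζ ε X y₀ u y Φ →
      ∀ (yT : BurgersControl.H), BurgersControl.ValueAt y T yT →
      ∀ (p : BurgersControl.W T), BurgersControl.IsDiscreteAdjoint ν yd yT y p →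
        ‖p‖ ≤ c * (BurgersControl.stateConst C u y₀ ^ 4 + BurgersControl.stateConst C u y₀ ^ 2)
          * ‖yT - yd‖ := by
  obtain ⟨C₀, hC₀, hbound⟩ :=
    mainTheorem11_general hν hT (hχ.continuous.memLp_of_hasCompactSupport hχc)
  refine ⟨C₀, hC₀, fun C hC δ hδ => ?_⟩
  obtain ⟨c, hc, hbound⟩ := hbound C hC δ hδ
  refine ⟨c, hc, ?_⟩
  intro y₀ yd _ _ _ _ u _ hu _ _ _ _ _ _ _ y _ hy yT _ p hp
  rw [norm_sub_rev]
  exact hbound y₀ u hu y hy.equation hy.valueAt_zero p _ hp.equation hp.valueAt_terminal
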